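/- Let $G=\mathbb R\ltimes\mathbb R$ be the affine group with law $(a,b)(a',b')=(a+a',\,b+e^{-a}b')$ and left Haar measure $d\mu(a,b)=e^{a}\,da\,db$, and let $\mathcal A=C_c^\infty(G)$ be its convolution algebra of compactly supported smooth complex-valued functions. For $\nu\in\{-1,0,1\}$ and $f\in\mathcal A$ let $\pi_\nu(f)$ be the bounded operator on $L^2(\mathbb R,ds)$ given by $$(\pi_\nu(f)\phi)(s)=\int_{\mathbb R^2} e^{a} f(a,b)\,e^{i\nu b e^{-s}}\phi(s+a)\,da\,db .$$ On the Hilbert space $\mathcal H=\bigoplus_{\nu\in\{-1,0,1\}}\big(L^2(\mathbb R,ds)\otimes\mathbb C^2\big)$ put $\pi(f)=\bigoplus_{\nu}\operatorname{diag}(\pi_\nu(f),\pi_\nu(f))$, and let $\mathcal D$ be the self-adjoint closure of the operator acting in each of the three summands as $\gamma^1\partial_1+\gamma^2\partial_2$ on $\mathbb C^2$-valued Schwartz functions, where $(\partial_1\phi)(s)=s\,\phi(s)$, $(\partial_2\phi)(s)=-i\,\phi'(s)$, $\gamma^1=\begin{pmatrix}0&1\\1&0\end{pmatrix}$ and $\gamma^2=\begin{pmatrix}0&-i\\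 i&0\end{pmatrix}$. Then for every $f\in\mathcal A$ the commutator $[(1+\mathcal D^2)^{-1/2},\pi(f)]$ is a trace-class operator on $\mathcal H$. -/

import Mathlib

open MeasureTheory
open scoped InnerProductSpace SchwartzMap

noncomputable section

set_option linter.unusedSectionVars false

namespace KappaAffine

section HilbertSpace

variable {E : Type*} [NormedAddCommGroup E] [InnerProductSpace ℂ E] [CompleteSpace E]

/-- The closure of the graph of an unbounded operator in the Hilbert sum `E ⊕ E`. -/
def graphClosure (T : E →ₗ.[ℂ] E) : Submodule ℂ (WithLp 2 (E × E)) :=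
  (T.graph.map ((WithLp.linearEquiv 2 ℂ (E × E)).symm : E × E →ₗ[ℂ] WithLp 2 (E × E))).topologicalClosure

instance (T : E →ₗ.[ℂ] E) : CompleteSpace (graphClosure T) :=
  (Submodule.isClosed_topologicalClosure _).completeSpace_coe

/-- The embedding `x ↦ (x, 0)` of `E` into the Hilbert sum `E ⊕ E`. -/
def inlL2 : E →L[ℂ] WithLp 2 (E × E) :=
  ((WithLp.prodContinuousLinearEquiv 2 ℂ E E).symm : E × E →L[ℂ] WithLp 2 (E × E)) ∘L
    ContinuousLinearMap.inl ℂ E E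

/-- `(1 + T²)⁻¹` for a self-adjoint operator `T`, as a bounded operator: `x` is sent to the first
component of the orthogonal projection of `(x, 0)` onto the graph of `T` (von Neumann).
`add_sq_invOneAddSq` and `invOneAddSq_add_sq` show that it is the two-sided inverse of `1 + T²`,
where `T²` has its natural domain `{y ∈ dom T | T y ∈ dom T}`. -/
def invOneAddSq (T : E →ₗ.[ℂ] E) : E →L[ℂ] E :=
  WithLp.fstL 2 ℂ E E ∘L (graphClosure T).starProjection ∘L inlL2

lemma inner_inlL2 (x : E) (z : WithLp 2 (E × E)) : ⟪inlL2 x, z⟫_ℂ = ⟪x, z.fst⟫_ℂ := by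
  simp [inlL2, WithLp.prod_inner_apply]

lemma mem_graphClosure_iff {T : E →ₗ.[ℂ] E} (hT : T.IsClosed) (z : WithLp 2 (E × E)) :
    z ∈ graphClosure T ↔ (z.fst, z.snd) ∈ T.graph := by
  have h1 : IsClosed ((T.graph.map ((WithLp.linearEquiv 2 ℂ (E × E)).symm :
      E × E →ₗ[ℂ] WithLp 2 (E × E)) : Submodule ℂ (WithLp 2 (E × E))) : Set (WithLp 2 (E × E))) := by
    rw [Submodule.map_coe, LinearEquiv.coe_coe, LinearEquiv.image_eq_preimage_symm]
    exact IsClosed.preimage (WithLp.prod_continuous_ofLp 2 E E) hT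
  rw [graphClosure, h1.submodule_topologicalClosure_eq, Submodule.mem_map]
  constructor
  · rintro ⟨y, hy, rfl⟩
    exact hy
  · intro h
    exact ⟨_, h, rfl⟩

lemma invOneAddSq_nonneg (T : E →ₗ.[ℂ] E) : 0 ≤ invOneAddSq T := by
  rw [ContinuousLinearMap.nonneg_iff_isPositive, ContinuousLinearMap.isPositive_iff_complex]
  intro x
  have h : ⟪invOneAddSq T x, x⟫_ℂ =
      ⟪(graphClosure T).starProjection (inlL2 x), inlL2 x⟫_ℂ := by
    rw [← inner_conj_symm, ← inner_conj_symm (inlL2 x |> (graphClosure T).starProjection),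
      inner_inlL2]
    rfl
  rw [h]
  have h2 := (graphClosure T).starProjection_isSymmetric.im_inner_apply_self (inlL2 x)
  have h3 := (graphClosure T).re_inner_starProjection_nonneg (inlL2 x)
  refine ⟨?_, h3⟩
  apply Complex.ext
  · simp
  · simpa using h2.symm

/-- For self-adjoint `T`, `invOneAddSq T` maps into the domain of `T²` and is a right inverse
of `1 + T²`. -/
lemma add_sq_invOneAddSq {T : E →ₗ.[ℂ] E} (hT : IsSelfAdjoint T) (x : E) :
    ∃ (h₁ : invOneAddSq T x ∈ T.domain) (h₂ : T ⟨invOneAddSq T x, h₁⟩ ∈ T.domain),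
      invOneAddSq T x + T ⟨T ⟨invOneAddSq T x, h₁⟩, h₂⟩ = x := by
  set p := (graphClosure T).starProjection (inlL2 x) with hp
  have hpm : p ∈ graphClosure T := (graphClosure T).starProjection_apply_mem _
  rw [mem_graphClosure_iff hT.isClosed] at hpm
  have hfst : invOneAddSq T x = p.fst := rfl
  obtain ⟨h₁, h₁'⟩ : ∃ h₁ : p.fst ∈ T.domain, T ⟨p.fst, h₁⟩ = p.snd := by
    simpa [LinearPMap.mem_graph_iff] using hpm
  have horth : ∀ y : T.domain, ⟪x - p.fst, (y : E)⟫_ℂ = ⟪p.snd, T y⟫_ℂ := by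
    intro y
    have := (graphClosure T).starProjection_inner_eq_zero (inlL2 x) (WithLp.toLp 2 ((y : E), T y))
      ((mem_graphClosure_iff hT.isClosed _).2 (T.mem_graph y))
    rw [← hp, inner_sub_left, inner_inlL2, WithLp.prod_inner_apply] at this
    rw [inner_sub_left]
    change ⟪x, (y : E)⟫_ℂ - (⟪p.fst, (y : E)⟫_ℂ + ⟪p.snd, T y⟫_ℂ) = 0 at this
    linear_combination this
  have h₂ : p.snd ∈ T.adjoint.domain := LinearPMap.mem_adjoint_domain_of_exists _ ⟨_, horth⟩
  have h₃ := LinearPMap.adjoint_apply_eq hT.dense_domain ⟨_, h₂⟩ horth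
  have key : ∀ S : E →ₗ.[ℂ] E, S = T → ∀ (h : p.snd ∈ S.domain), S ⟨_, h⟩ = x - p.fst →
      ∃ h : p.snd ∈ T.domain, T ⟨_, h⟩ = x - p.fst := by
    rintro S rfl h h'
    exact ⟨h, h'⟩
  obtain ⟨h₄, h₅⟩ := key _ (LinearPMap.isSelfAdjoint_def.1 hT) h₂ h₃
  refine ⟨h₁, ?_, ?_⟩
  · change T ⟨p.fst, h₁⟩ ∈ _
    rw [h₁']; exact h₄
  · change p.fst + T ⟨T ⟨p.fst, h₁⟩, _⟩ = x
    simp only [h₁', h₅, add_sub_cancel]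

/-- For self-adjoint `T`, `invOneAddSq T` is a left inverse of `1 + T²`. -/
lemma invOneAddSq_add_sq {T : E →ₗ.[ℂ] E} (hT : IsSelfAdjoint T) (y : T.domain)
    (hy : T y ∈ T.domain) : invOneAddSq T ((y : E) + T ⟨T y, hy⟩) = y := by
  have h : (graphClosure T).starProjection (inlL2 ((y : E) + T ⟨T y, hy⟩)) =
      WithLp.toLp 2 ((y : E), T y) := by
    refine Submodule.eq_starProjection_of_mem_of_inner_eq_zero
      ((mem_graphClosure_iff hT.isClosed (WithLp.toLp 2 ((y : E), T y))).2 (T.mem_graph y)) ?_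
    intro w hw
    rw [mem_graphClosure_iff hT.isClosed] at hw
    obtain ⟨h₁, h₁'⟩ : ∃ h₁ : w.fst ∈ T.domain, T ⟨w.fst, h₁⟩ = w.snd := by
      simpa [LinearPMap.mem_graph_iff] using hw
    have hs := LinearPMap.adjoint_isFormalAdjoint hT.dense_domain
    rw [LinearPMap.isSelfAdjoint_def.1 hT] at hs
    have := hs ⟨T y, hy⟩ ⟨w.fst, h₁⟩
    rw [inner_sub_left, inner_inlL2, WithLp.prod_inner_apply, inner_add_left]
    simp only [h₁'] at this
    change _ - (⟪(y : E), w.fst⟫_ℂ + ⟪T y, w.snd⟫_ℂ) = 0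
    rw [this]; ring
  exact congrArg WithLp.fst h

/-- `(1 + T²)^(-1/2)` for a self-adjoint operator `T`: the positive square root of
`(1 + T²)⁻¹`. -/
def invSqrtOneAddSq (T : E →ₗ.[ℂ] E) : E →L[ℂ] E := CFC.sqrt (invOneAddSq T)

lemma invSqrtOneAddSq_nonneg (T : E →ₗ.[ℂ] E) : 0 ≤ invSqrtOneAddSq T := CFC.sqrt_nonneg _

lemma invSqrtOneAddSq_mul_self (T : E →ₗ.[ℂ] E) :
    invSqrtOneAddSq T * invSqrtOneAddSq T = invOneAddSq T :=
  CFC.sqrt_mul_sqrt_self _ (invOneAddSq_nonneg T)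

universe u

/-- A bounded operator `A` on a Hilbert space is trace class if `Tr |A| < ∞`, where
`|A| = (A* A)^(1/2)` and the trace is computed in any Hilbert basis. -/
def IsTraceClass {F : Type u} [NormedAddCommGroup F] [InnerProductSpace ℂ F] [CompleteSpace F]
    (A : F →L[ℂ] F) : Prop :=
  ∀ (ι : Type u) (b : HilbertBasis ι ℂ F), Summable fun i => (⟪b i, CFC.abs A (b i)⟫_ℂ).re

end HilbertSpace
/-- The Hilbert space `L²(ℝ, ds)`. -/
abbrev L2 : Type := Lp ℂ 2 (volume : Measure ℝ)

section Representation

/-- The (underlying space of the) algebra `𝒜 = 𝒟(G)_*` of compactly supported smooth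
complex-valued functions `(a, b) ↦ f(a, b)` on the affine group `G = ℝ ⋉ ℝ`. -/
def smoothAlgebra : Submodule ℂ (ℝ × ℝ → ℂ) where
  carrier := {f | ContDiff ℝ (⊤ : ℕ∞) f ∧ HasCompactSupport f}
  zero_mem' := ⟨contDiff_const, HasCompactSupport.zero⟩
  add_mem' hf hg := ⟨hf.1.add hg.1, hf.2.add hg.2⟩
  smul_mem' c _ hf := ⟨hf.1.const_smul c, hf.2.smul_left (f := fun _ : ℝ × ℝ => c)⟩

lemma memLp_phaseMul (θ : C(ℝ, ℝ)) (φ : L2) :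
    MemLp (fun s => Complex.exp (θ s * Complex.I) * φ s) 2 volume :=
  (Lp.memLp φ).of_le
    ((by fun_prop : Continuous fun s : ℝ =>
      Complex.exp (θ s * Complex.I)).aestronglyMeasurable.mul (Lp.aestronglyMeasurable φ))
    (.of_forall fun s => by rw [norm_mul, Complex.norm_exp_ofReal_mul_I, one_mul])

/-- Multiplication by the phase `s ↦ exp(i θ(s))` on `L²(ℝ)`. -/
def phaseMul (θ : C(ℝ, ℝ)) : L2 →ₗᵢ[ℂ] L2 where
  toFun φ := (memLp_phaseMul θ φ).toLp
  map_add' φ ψ := by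
    rw [← MemLp.toLp_add, MemLp.toLp_eq_toLp_iff]
    filter_upwards [Lp.coeFn_add φ ψ] with s hs
    rw [hs]; exact mul_add _ _ _
  map_smul' c φ := by
    rw [RingHom.id_apply, ← MemLp.toLp_const_smul, MemLp.toLp_eq_toLp_iff]
    filter_upwards [Lp.coeFn_smul c φ] with s hs
    rw [hs]; exact mul_left_comm _ _ _
  norm_map' φ := by
    change ‖(memLp_phaseMul θ φ).toLp‖ = _
    rw [Lp.norm_toLp, Lp.norm_def]
    congr 1
    refine eLpNorm_congr_norm_ae (.of_forall fun s => ?_)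
    rw [norm_mul, Complex.norm_exp_ofReal_mul_I, one_mul]

lemma phaseMul_coeFn (θ : C(ℝ, ℝ)) (φ : L2) :
    phaseMul θ φ =ᵐ[volume] fun s => Complex.exp (θ s * Complex.I) * φ s :=
  (memLp_phaseMul θ φ).coeFn_toLp

/-- The unitary operators `(π_ν(a, b) φ)(s) = exp(i ν b e^{-s}) φ(s + a)` of the affine
group on `L²(ℝ)`, for `ν ∈ {-1, 0, 1}` and `p = (a, b)`. -/
def groupRep (ν : SignType) (p : ℝ × ℝ) : L2 →ₗᵢ[ℂ] L2 :=
  (phaseMul ⟨fun s => (ν : ℝ) * p.2 * Real.exp (-s), by fun_prop⟩).comp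
    (Lp.compMeasurePreservingₗᵢ ℂ (fun s : ℝ => s + p.1) (measurePreserving_add_right volume p.1))

lemma groupRep_coeFn (ν : SignType) (p : ℝ × ℝ) (φ : L2) :
    groupRep ν p φ =ᵐ[volume] fun s =>
      Complex.exp (((ν : ℝ) * p.2 * Real.exp (-s) : ℝ) * Complex.I) * φ (s + p.1) := by
  refine (phaseMul_coeFn _ _).trans ?_
  filter_upwards [Lp.coeFn_compMeasurePreserving φ (measurePreserving_add_right volume p.1)]
    with s hs
  change _ * (Lp.compMeasurePreserving _ _ φ : L2) s = _
  rw [hs]; rfl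

lemma continuous_phaseMul {X : Type*} [TopologicalSpace X] [FirstCountableTopology X]
    (θ : X → C(ℝ, ℝ)) (hθ : ∀ s, Continuous fun x => θ x s) (φ : L2) :
    Continuous fun x => phaseMul (θ x) φ := by
  rw [continuous_iff_continuousAt]
  intro x₀
  have hc : Continuous fun x => ⟪phaseMul (θ x₀) φ, phaseMul (θ x) φ⟫_ℂ := by
    have h : ∀ x, ⟪phaseMul (θ x₀) φ, phaseMul (θ x) φ⟫_ℂ =
        ∫ s, Complex.exp ((θ x s - θ x₀ s : ℝ) * Complex.I) * ⟪φ s, φ s⟫_ℂ := by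
      intro x
      rw [L2.inner_def]
      refine integral_congr_ae ?_
      filter_upwards [phaseMul_coeFn (θ x₀) φ, phaseMul_coeFn (θ x) φ] with s h₁ h₂
      rw [h₁, h₂]
      simp only [RCLike.inner_apply, map_mul, ← Complex.exp_conj, Complex.conj_ofReal,
        Complex.conj_I]
      rw [show ((θ x s - θ x₀ s : ℝ) * Complex.I) = θ x s * Complex.I + θ x₀ s * -Complex.I by
        push_cast; ring, Complex.exp_add]
      ring
    simp_rw [h]
    refine continuous_of_dominated (bound := fun s => ‖⟪φ s, φ s⟫_ℂ‖) ?_ ?_ ?_ ?_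
    · intro x
      exact (by fun_prop : Continuous fun s : ℝ =>
        Complex.exp ((θ x s - θ x₀ s : ℝ) * Complex.I)).aestronglyMeasurable.mul
          (L2.integrable_inner (𝕜 := ℂ) φ φ).aestronglyMeasurable
    · intro x
      refine .of_forall fun s => ?_
      rw [norm_mul, Complex.norm_exp_ofReal_mul_I, one_mul]
    · exact (L2.integrable_inner (𝕜 := ℂ) φ φ).norm
    · refine .of_forall fun s => ?_
      have := hθ s
      fun_prop
  have h2 : ∀ x, ‖phaseMul (θ x) φ - phaseMul (θ x₀) φ‖ ^ 2 =
      2 * ‖φ‖ ^ 2 - 2 * (⟪phaseMul (θ x₀) φ, phaseMul (θ x) φ⟫_ℂ).re := by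
    intro x
    rw [norm_sub_rev, norm_sub_sq (𝕜 := ℂ), LinearIsometry.norm_map, LinearIsometry.norm_map]
    simp only [RCLike.re_to_complex]
    ring
  have h3 : Continuous fun x => ‖phaseMul (θ x) φ - phaseMul (θ x₀) φ‖ ^ 2 := by
    simp_rw [h2]; fun_prop
  rw [ContinuousAt, tendsto_iff_norm_sub_tendsto_zero]
  have h4 := (h3.sqrt).tendsto x₀
  simpa [Real.sqrt_sq] using h4

lemma continuous_groupRep (ν : SignType) (φ : L2) : Continuous fun p => groupRep ν p φ := by
  rw [continuous_iff_continuousAt]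
  intro p₀
  let θ : ℝ × ℝ → C(ℝ, ℝ) := fun p => ⟨fun s => (ν : ℝ) * p.2 * Real.exp (-s), by fun_prop⟩
  let τ : ℝ × ℝ → L2 := fun p =>
    Lp.compMeasurePreserving (fun s : ℝ => s + p.1) (measurePreserving_add_right volume p.1) φ
  have hτ : Continuous τ := by
    have hg : Continuous fun p : ℝ × ℝ => (⟨fun s => s + p.1, by fun_prop⟩ : C(ℝ, ℝ)) :=
      ContinuousMap.continuous_of_continuous_uncurry _ (by
        change Continuous fun q : (ℝ × ℝ) × ℝ => q.2 + q.1.1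
        fun_prop)
    exact Continuous.compMeasurePreservingLp (p := 2) (continuous_const (y := φ)) hg
      (fun p => measurePreserving_add_right volume p.1) (by simp)
  have h1 : ∀ p, groupRep ν p φ = phaseMul (θ p) (τ p) := fun p => rfl
  have h2 := (continuous_phaseMul θ (fun s => by
    change Continuous fun p : ℝ × ℝ => (ν : ℝ) * p.2 * Real.exp (-s); fun_prop) (τ p₀)).tendsto p₀
  have h3 : Filter.Tendsto (fun p => phaseMul (θ p) (τ p - τ p₀)) (nhds p₀) (nhds 0) := by
    rw [tendsto_zero_iff_norm_tendsto_zero]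
    simp_rw [LinearIsometry.norm_map]
    have := ((hτ.sub continuous_const).norm (f := fun p => τ p - τ p₀)).tendsto p₀
    simpa using this
  have h4 := h3.add h2
  rw [ContinuousAt]
  simp_rw [h1]
  simpa using h4

lemma integrable_rep (ν : SignType) (f : smoothAlgebra) (φ : L2) :
    Integrable fun p : ℝ × ℝ => ((Real.exp p.1 : ℂ) * f.1 p) • groupRep ν p φ := by
  have hc := continuous_groupRep ν φ
  have hf := f.2.1.continuous
  refine Continuous.integrable_of_hasCompactSupport (by fun_prop) (f.2.2.mono fun p hp hf0 => hp ?_)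
  simp [hf0]

/-- The integrated representation `π_ν(f) φ = ∫_G f(a, b) π_ν(a, b) φ dμ(a, b)` on `L²(ℝ)`, where
`dμ(a, b) = e^a da db` is the left Haar measure of `G` (a Bochner integral in `L²(ℝ)`). -/
def rep (ν : SignType) (f : smoothAlgebra) : L2 →L[ℂ] L2 :=
  LinearMap.mkContinuous
    { toFun := fun φ => ∫ p : ℝ × ℝ, ((Real.exp p.1 : ℂ) * f.1 p) • groupRep ν p φ
      map_add' := fun φ ψ => by
        simp_rw [map_add, smul_add]
        exact integral_add (integrable_rep ν f φ) (integrable_rep ν f ψ)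
      map_smul' := fun c φ => by
        simp_rw [map_smul, smul_comm _ c]
        exact integral_smul c fun p : ℝ × ℝ => ((Real.exp p.1 : ℂ) * f.1 p) • groupRep ν p φ }
    (∫ p : ℝ × ℝ, ‖(Real.exp p.1 : ℂ) * f.1 p‖)
    (fun φ => by
      refine (norm_integral_le_integral_norm _).trans_eq ?_
      simp_rw [norm_smul, LinearIsometry.norm_map]
      exact integral_mul_const _ _)

/-- The Hilbert space `⊕_{ν ∈ {-1, 0, 1}} L²(ℝ) ⊗ ℂ²`; the component with index `(ν, j)` is the
`j`-th spinor component in the summand `ν`. -/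
abbrev H : Type := PiLp 2 fun _ : SignType × Fin 2 => L2

/-- The representation `π = ⊕_ν diag(π_ν, π_ν)`. -/
def repH (f : smoothAlgebra) : H →L[ℂ] H :=
  ((PiLp.continuousLinearEquiv 2 ℂ fun _ : SignType × Fin 2 => L2).symm :
      (SignType × Fin 2 → L2) →L[ℂ] H) ∘L
    ContinuousLinearMap.pi fun i => rep i.1 f ∘L PiLp.proj 2 (fun _ => L2) i

lemma repH_apply (f : smoothAlgebra) (ψ : H) (i : SignType × Fin 2) :
    repH f ψ i = rep i.1 f (ψ i) := rfl

end Representation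

section Dirac

/-- `(∂₁ φ)(s) = s φ(s)` on Schwartz functions. -/
def posS : 𝓢(ℝ, ℂ) →ₗ[ℂ] 𝓢(ℝ, ℂ) := (SchwartzMap.smulLeftCLM ℂ (fun s : ℝ => (s : ℂ))).toLinearMap

/-- `(∂₂ φ)(s) = -i φ'(s)` on Schwartz functions. -/
def momS : 𝓢(ℝ, ℂ) →ₗ[ℂ] 𝓢(ℝ, ℂ) := (-Complex.I) • (SchwartzMap.derivCLM ℂ ℂ).toLinearMap

lemma posS_apply (φ : 𝓢(ℝ, ℂ)) (s : ℝ) : posS φ s = s * φ s := by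
  have : (fun s : ℝ => (s : ℂ)).HasTemperateGrowth := Complex.ofRealCLM.hasTemperateGrowth
  simp [posS, SchwartzMap.smulLeftCLM_apply_apply this]

lemma momS_apply (φ : 𝓢(ℝ, ℂ)) (s : ℝ) : momS φ s = -Complex.I * deriv φ s := by
  simp [momS]

/-- The first Pauli matrix. -/
def γ₁ : Matrix (Fin 2) (Fin 2) ℂ := !![0, 1; 1, 0]
/-- The second Pauli matrix. -/
def γ₂ : Matrix (Fin 2) (Fin 2) ℂ := !![0, -Complex.I; Complex.I, 0]

/-- `γ¹ ∂₁ + γ² ∂₂`, acting on each of the three summands, on Schwartz spinors. -/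
def diracS : (SignType × Fin 2 → 𝓢(ℝ, ℂ)) →ₗ[ℂ] (SignType × Fin 2 → 𝓢(ℝ, ℂ)) :=
  LinearMap.pi fun i => ∑ j : Fin 2,
    (γ₁ i.2 j • posS + γ₂ i.2 j • momS) ∘ₗ LinearMap.proj (i.1, j)

/-- The inclusion of Schwartz spinors in the Hilbert space. -/
def embS : (SignType × Fin 2 → 𝓢(ℝ, ℂ)) →ₗ[ℂ] H :=
  ((WithLp.linearEquiv 2 ℂ (SignType × Fin 2 → L2)).symm :
      (SignType × Fin 2 → L2) →ₗ[ℂ] H) ∘ₗ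
    LinearMap.pi fun i => (SchwartzMap.toLpCLM ℂ ℂ 2 (volume : Measure ℝ)).toLinearMap ∘ₗ
      LinearMap.proj i

lemma embS_apply (φ : SignType × Fin 2 → 𝓢(ℝ, ℂ)) (i : SignType × Fin 2) :
    embS φ i = (φ i).toLp 2 := rfl

lemma embS_injective : Function.Injective embS := by
  intro φ ψ h
  funext i
  exact SchwartzMap.injective_toLp 2 (volume : Measure ℝ) (congrArg (fun v : H => v i) h)

/-- `γ¹ ∂₁ + γ² ∂₂` as an unbounded operator whose domain is the space of Schwartz spinors. -/
def diracCore : H →ₗ.[ℂ] H where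
  domain := LinearMap.range embS
  toFun := embS ∘ₗ diracS ∘ₗ (LinearEquiv.ofInjective embS embS_injective).symm.toLinearMap

/-- The operator `𝒟`: the closure of `γ¹ ∂₁ + γ² ∂₂` on Schwartz spinors. It is self-adjoint
(`isSelfAdjoint_dirac`), hence the unique self-adjoint extension. -/
def dirac : H →ₗ.[ℂ] H := diracCore.closure

end Dirac
section SelfAdjoint

/-- A symmetric operator with trivial deficiency spaces is essentially self-adjoint. -/
lemma isSelfAdjoint_closure {E : Type*} [NormedAddCommGroup E] [InnerProductSpace ℂ E]
    [CompleteSpace E] {T : E →ₗ.[ℂ] E} (hd : Dense (T.domain : Set E)) (hs : T.IsFormalAdjoint T)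
    (h₁ : ∀ u : E, (∀ x : T.domain, ⟪u, T x + Complex.I • (x : E)⟫_ℂ = 0) → u = 0)
    (h₂ : ∀ u : E, (∀ x : T.domain, ⟪u, T x + (-Complex.I) • (x : E)⟫_ℂ = 0) → u = 0) :
    IsSelfAdjoint T.closure := by
  have hle : T ≤ T.adjoint := hs.le_adjoint hd
  have hac : T.adjoint.IsClosed := LinearPMap.adjoint_isClosed hd
  have hcl : T.IsClosable := hac.isClosable.leIsClosable hle
  have hgS : T.graph.topologicalClosure = T.closure.graph := hcl.graph_closure_eq_closure_graph
  have hdS : Dense (T.closure.domain : Set E) := hd.mono T.le_closure.1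
  have hadj : T.closure.graph.adjoint = T.graph.adjoint := by
    ext x
    rw [Submodule.mem_adjoint_iff, Submodule.mem_adjoint_iff]
    constructor
    · intro h a b hab
      exact h a b (LinearPMap.le_graph_of_le T.le_closure hab)
    · intro h a b hab
      have hc : IsClosed {z : E × E | ⟪z.2, x.1⟫_ℂ - ⟪z.1, x.2⟫_ℂ = 0} :=
        isClosed_eq (by fun_prop) continuous_const
      rw [← hgS] at hab
      exact closure_minimal (fun z hz => h z.1 z.2 hz) hc hab
  rw [LinearPMap.isSelfAdjoint_def]
  apply LinearPMap.eq_of_eq_graph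
  rw [LinearPMap.adjoint_graph_eq_graph_adjoint hdS, hadj,
    ← LinearPMap.adjoint_graph_eq_graph_adjoint hd]
  apply le_antisymm
  · intro w hw
    obtain ⟨a, b⟩ := w
    set p := (graphClosure T.closure).starProjection (WithLp.toLp 2 (a, b)) with hp
    have hpS : (p.fst, p.snd) ∈ T.closure.graph :=
      (mem_graphClosure_iff hcl.closure_isClosed p).1
        ((graphClosure T.closure).starProjection_apply_mem _)
    have hpA : (p.fst, p.snd) ∈ T.adjoint.graph :=
      (hgS ▸ Submodule.topologicalClosure_minimal _ (LinearPMap.le_graph_of_le hle) hac) hpS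
    have hz : (a - p.fst, b - p.snd) ∈ T.adjoint.graph := sub_mem hw hpA
    have hB : ∀ x : T.domain, ⟪a - p.fst, T x⟫_ℂ = ⟪b - p.snd, (x : E)⟫_ℂ := by
      intro x
      rw [LinearPMap.adjoint_graph_eq_graph_adjoint hd, Submodule.mem_adjoint_iff] at hz
      have := hz x (T x) (T.mem_graph x)
      rw [sub_eq_zero] at this
      rw [← inner_conj_symm, this, inner_conj_symm]
    have hA : ∀ x : T.domain, ⟪b - p.snd, T x⟫_ℂ = - ⟪a - p.fst, (x : E)⟫_ℂ := by
      intro x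
      have := (graphClosure T.closure).starProjection_inner_eq_zero (WithLp.toLp 2 (a, b))
        (WithLp.toLp 2 ((x : E), T x)) ((mem_graphClosure_iff hcl.closure_isClosed
          (WithLp.toLp 2 ((x : E), T x))).2
            (LinearPMap.le_graph_of_le T.le_closure (T.mem_graph x)))
      rw [← hp, WithLp.prod_inner_apply] at this
      change ⟪a - p.fst, (x : E)⟫_ℂ + ⟪b - p.snd, T x⟫_ℂ = 0 at this
      linear_combination this
    set z := a - p.fst with hzd
    set y := b - p.snd with hyd
    have e₁ : y + Complex.I • z = 0 := h₁ _ fun x => by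
      simp only [inner_add_left, inner_add_right, inner_smul_left, inner_smul_right, hA, hB,
        Complex.conj_I]
      linear_combination (-⟪z, (x : E)⟫_ℂ) * Complex.I_mul_I
    have e₂ : y - Complex.I • z = 0 := h₂ _ fun x => by
      simp only [inner_sub_left, inner_add_right, inner_smul_left, inner_smul_right, hA, hB,
        Complex.conj_I]
      linear_combination (-⟪z, (x : E)⟫_ℂ) * Complex.I_mul_I
    have e₃ : y = 0 := by
      have : (2 : ℂ) • y = 0 := by
        rw [two_smul]
        calc y + y = (y + Complex.I • z) + (y - Complex.I • z) := by abel
          _ = 0 := by rw [e₁, e₂, add_zero]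
      simpa using this
    have e₄ : z = 0 := by simpa [e₃] using e₁
    rw [sub_eq_zero.1 e₃, sub_eq_zero.1 e₄]
    exact hpS
  · rw [← hgS]
    exact Submodule.topologicalClosure_minimal _ (LinearPMap.le_graph_of_le hle) hac

lemma inner_posS (φ ψ : 𝓢(ℝ, ℂ)) :
    ⟪(posS φ).toLp 2, ψ.toLp 2⟫_ℂ = ⟪φ.toLp 2, (posS ψ).toLp 2⟫_ℂ := by
  rw [SchwartzMap.inner_toL2_toL2_eq _ _ volume, SchwartzMap.inner_toL2_toL2_eq _ _ volume]
  congr 1; ext s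
  simp only [posS_apply, RCLike.inner_apply, map_mul, Complex.conj_ofReal]; ring

/-- Complex conjugation on Schwartz space. -/
def conjS (φ : 𝓢(ℝ, ℂ)) : 𝓢(ℝ, ℂ) :=
  SchwartzMap.postcompCLM (𝕜 := ℝ) (Complex.conjCLE : ℂ →L[ℝ] ℂ) φ

lemma inner_momS (φ ψ : 𝓢(ℝ, ℂ)) :
    ⟪(momS φ).toLp 2, ψ.toLp 2⟫_ℂ = ⟪φ.toLp 2, (momS ψ).toLp 2⟫_ℂ := by
  rw [SchwartzMap.inner_toL2_toL2_eq _ _ volume, SchwartzMap.inner_toL2_toL2_eq _ _ volume]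
  have h := SchwartzMap.integral_mul_deriv_eq_neg_deriv_mul (conjS φ) ψ
  have hc : ∀ s, conjS φ s = starRingEnd ℂ (φ s) := fun s => rfl
  have hd : ∀ s, deriv (conjS φ) s = starRingEnd ℂ (deriv φ s) := fun s => by
    have := (Complex.conjCLE : ℂ →L[ℝ] ℂ).hasFDerivAt.comp_hasDerivAt s (φ.hasDerivAt s)
    exact this.deriv
  simp_rw [hc, hd] at h
  simp only [momS_apply, RCLike.inner_apply, map_mul, map_neg, Complex.conj_I, neg_neg]
  have h1 : ∀ s, ψ s * (Complex.I * starRingEnd ℂ (deriv φ s)) =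
      Complex.I * (starRingEnd ℂ (deriv φ s) * ψ s) := fun s => by ring
  have h2 : ∀ s, -Complex.I * deriv ψ s * starRingEnd ℂ (φ s) =
      -Complex.I * (starRingEnd ℂ (φ s) * deriv ψ s) := fun s => by ring
  simp_rw [h1, h2]
  rw [integral_const_mul, integral_const_mul, h]; ring

lemma diracS_zero (φ : SignType × Fin 2 → 𝓢(ℝ, ℂ)) (ν : SignType) :
    diracS φ (ν, 0) = posS (φ (ν, 1)) - Complex.I • momS (φ (ν, 1)) := by
  simp [diracS, γ₁, γ₂, sub_eq_add_neg]

lemma diracS_one (φ : SignType × Fin 2 → 𝓢(ℝ, ℂ)) (ν : SignType) :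
    diracS φ (ν, 1) = posS (φ (ν, 0)) + Complex.I • momS (φ (ν, 0)) := by
  simp [diracS, γ₁, γ₂]

lemma toLp_add' (φ ψ : 𝓢(ℝ, ℂ)) :
    (φ + ψ).toLp 2 volume = φ.toLp 2 volume + ψ.toLp 2 volume := rfl

lemma toLp_smul' (c : ℂ) (φ : 𝓢(ℝ, ℂ)) :
    (c • φ).toLp 2 volume = c • φ.toLp 2 volume := rfl

lemma toLp_sub' (φ ψ : 𝓢(ℝ, ℂ)) :
    (φ - ψ).toLp 2 volume = φ.toLp 2 volume - ψ.toLp 2 volume :=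
  map_sub (SchwartzMap.toLpCLM ℂ ℂ 2 (volume : Measure ℝ)) φ ψ

lemma inner_diracS (φ ψ : SignType × Fin 2 → 𝓢(ℝ, ℂ)) :
    ⟪embS (diracS φ), embS ψ⟫_ℂ = ⟪embS φ, embS (diracS ψ)⟫_ℂ := by
  simp only [PiLp.inner_apply, Fintype.sum_prod_type, Fin.sum_univ_two, embS_apply, diracS_zero,
    diracS_one, toLp_add', toLp_sub', toLp_smul', inner_add_left, inner_sub_left, inner_add_right,
    inner_sub_right, inner_smul_left, inner_smul_right, inner_posS, inner_momS, Complex.conj_I]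
  refine Finset.sum_congr rfl fun ν _ => ?_
  ring

lemma diracCore_apply (φ : SignType × Fin 2 → 𝓢(ℝ, ℂ)) :
    diracCore ⟨embS φ, LinearMap.mem_range_self embS φ⟩ = embS (diracS φ) := by
  have h : (LinearEquiv.ofInjective embS embS_injective).symm
      ⟨embS φ, LinearMap.mem_range_self embS φ⟩ = φ :=
    (LinearEquiv.symm_apply_eq _).2 rfl
  exact congrArg (fun χ => embS (diracS χ)) h

lemma dense_diracCore : Dense (diracCore.domain : Set H) := by
  have h1 : DenseRange (fun φ : SignType × Fin 2 → 𝓢(ℝ, ℂ) =>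
      fun i => SchwartzMap.toLpCLM ℝ ℂ 2 (volume : Measure ℝ) (φ i)) :=
    DenseRange.piMap fun i => SchwartzMap.denseRange_toLpCLM (by simp)
  have h2 := (PiLp.continuousLinearEquiv 2 ℂ fun _ : SignType × Fin 2 => L2).symm.surjective.denseRange.comp
    h1 (PiLp.continuousLinearEquiv 2 ℂ fun _ : SignType × Fin 2 => L2).symm.continuous
  exact h2

lemma exists_bound_gauss (P : Polynomial ℂ) (k : ℕ) :
    ∃ C : ℝ, ∀ s : ℝ, |s| ^ k * (‖P.eval (s : ℂ)‖ * Real.exp (-s ^ 2 / 2)) ≤ C := by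
  induction P using Polynomial.induction_on' with
  | add P Q hP hQ =>
    obtain ⟨C, hC⟩ := hP
    obtain ⟨D, hD⟩ := hQ
    refine ⟨C + D, fun s => ?_⟩
    rw [Polynomial.eval_add]
    calc _ ≤ |s| ^ k * ((‖P.eval (s : ℂ)‖ + ‖Q.eval (s : ℂ)‖) * Real.exp (-s ^ 2 / 2)) := by
          gcongr; exact norm_add_le _ _
      _ ≤ C + D := by linarith [hC s, hD s]
  | monomial n a =>
    have key : ∀ s : ℝ, |s| ^ (k + n) * Real.exp (-s ^ 2 / 2) ≤
        1 + 2 ^ (k + n) * (k + n).factorial := by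
      intro s
      set m := k + n
      have h1 := Real.pow_div_factorial_le_exp (x := s ^ 2 / 2) (by positivity) m
      rw [div_le_iff₀ (by positivity)] at h1
      have h2 : Real.exp (-s ^ 2 / 2) * Real.exp (s ^ 2 / 2) = 1 := by
        rw [← Real.exp_add]; ring_nf; simp
      have h3 : (s ^ 2) ^ m * Real.exp (-s ^ 2 / 2) ≤ 2 ^ m * m.factorial := by
        calc (s ^ 2) ^ m * Real.exp (-s ^ 2 / 2)
            = 2 ^ m * (s ^ 2 / 2) ^ m * Real.exp (-s ^ 2 / 2) := by rw [← mul_pow]; ring_nf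
          _ ≤ 2 ^ m * (Real.exp (s ^ 2 / 2) * m.factorial) * Real.exp (-s ^ 2 / 2) := by gcongr
          _ = 2 ^ m * m.factorial * (Real.exp (-s ^ 2 / 2) * Real.exp (s ^ 2 / 2)) := by ring
          _ = _ := by rw [h2, mul_one]
      have h4 : |s| ^ m ≤ 1 + (s ^ 2) ^ m := by
        have : (s ^ 2) ^ m = (|s| ^ m) ^ 2 := by rw [← sq_abs, ← pow_mul, ← pow_mul, mul_comm]
        rw [this]; nlinarith [sq_nonneg (|s| ^ m - 1), sq_nonneg (|s| ^ m)]
      have h5 : Real.exp (-s ^ 2 / 2) ≤ 1 := Real.exp_le_one_iff.2 (by nlinarith [sq_nonneg s])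
      calc _ ≤ (1 + (s ^ 2) ^ m) * Real.exp (-s ^ 2 / 2) := by gcongr
        _ ≤ _ := by linarith
    refine ⟨‖a‖ * (1 + 2 ^ (k + n) * (k + n).factorial), fun s => ?_⟩
    rw [Polynomial.eval_monomial, norm_mul, norm_pow, Complex.norm_real, Real.norm_eq_abs]
    calc _ = ‖a‖ * (|s| ^ (k + n) * Real.exp (-s ^ 2 / 2)) := by ring
      _ ≤ _ := by gcongr; exact key s

lemma hasDerivAt_gauss (ξ s : ℝ) :
    HasDerivAt (fun s : ℝ => Complex.exp (-(s : ℂ) ^ 2 / 2 + Complex.I * ξ * s))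
      ((-s + Complex.I * ξ) * Complex.exp (-(s : ℂ) ^ 2 / 2 + Complex.I * ξ * s)) s := by
  have h : HasDerivAt (fun z : ℂ => Complex.exp (-z ^ 2 / 2 + Complex.I * ξ * z))
      (Complex.exp (-(s : ℂ) ^ 2 / 2 + Complex.I * ξ * s) *
        (-(2 * (s : ℂ)) / 2 + Complex.I * ξ)) (s : ℂ) := by
    have := ((((hasDerivAt_id (s : ℂ)).pow 2).neg.div_const 2).add
      ((hasDerivAt_id (s : ℂ)).const_mul (Complex.I * ξ))).cexp
    convert! this using 1
    simp
  convert! h.comp_ofReal using 1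
  ring

lemma norm_gauss (ξ s : ℝ) :
    ‖Complex.exp (-(s : ℂ) ^ 2 / 2 + Complex.I * ξ * s)‖ = Real.exp (-s ^ 2 / 2) := by
  rw [Complex.norm_exp]
  congr 1
  rw [show -(s : ℂ) ^ 2 / 2 + Complex.I * ξ * s = ((-s ^ 2 / 2 : ℝ) : ℂ) + ((ξ * s : ℝ) : ℂ) * Complex.I by
    push_cast; ring, Complex.add_re, Complex.ofReal_re, Complex.re_ofReal_mul, Complex.I_re,
    mul_zero, add_zero]

lemma iteratedDeriv_gauss (ξ : ℝ) (n : ℕ) : ∃ P : Polynomial ℂ, ∀ s : ℝ,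
    iteratedDeriv n (fun s : ℝ => Complex.exp (-(s : ℂ) ^ 2 / 2 + Complex.I * ξ * s)) s =
      P.eval (s : ℂ) * Complex.exp (-(s : ℂ) ^ 2 / 2 + Complex.I * ξ * s) := by
  induction n with
  | zero => exact ⟨1, fun s => by simp⟩
  | succ n ih =>
    obtain ⟨P, hP⟩ := ih
    refine ⟨P.derivative + P * (-Polynomial.X + Polynomial.C (Complex.I * ξ)), fun s => ?_⟩
    rw [iteratedDeriv_succ, funext hP]
    have h1 := ((P.hasDerivAt (s : ℂ)).comp_ofReal).mul (hasDerivAt_gauss ξ s)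
    refine h1.deriv.trans ?_
    simp; ring

/-- The Gaussian wave packet `s ↦ exp(-s²/2 + iξs)`. -/
def gaussS (ξ : ℝ) : 𝓢(ℝ, ℂ) where
  toFun s := Complex.exp (-(s : ℂ) ^ 2 / 2 + Complex.I * ξ * s)
  smooth' := by
    have : ContDiff ℝ (⊤ : ℕ∞) (fun s : ℝ => (s : ℂ)) := Complex.ofRealCLM.contDiff
    fun_prop
  decay' k n := by
    obtain ⟨P, hP⟩ := iteratedDeriv_gauss ξ n
    obtain ⟨C, hC⟩ := exists_bound_gauss P k
    refine ⟨C, fun s => ?_⟩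
    rw [norm_iteratedFDeriv_eq_norm_iteratedDeriv, hP, norm_mul, norm_gauss]
    exact hC s

lemma gaussS_apply (ξ s : ℝ) :
    gaussS ξ s = Complex.exp (-(s : ℂ) ^ 2 / 2 + Complex.I * ξ * s) := rfl

lemma momS_gaussS (ξ : ℝ) :
    momS (gaussS ξ) = Complex.I • posS (gaussS ξ) + (ξ : ℂ) • gaussS ξ := by
  ext s
  have hd : deriv (gaussS ξ) s = _ := (hasDerivAt_gauss ξ s).deriv
  rw [momS_apply, hd]
  simp only [SchwartzMap.add_apply, SchwartzMap.smul_apply, posS_apply, gaussS_apply, smul_eq_mul]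
  linear_combination (-ξ * Complex.exp (-(s : ℂ) ^ 2 / 2 + Complex.I * ξ * s)) * Complex.I_mul_I

lemma inner_toLp_eq (u : L2) (φ : 𝓢(ℝ, ℂ)) :
    ⟪u, φ.toLp 2⟫_ℂ = ∫ s, starRingEnd ℂ (u s) * φ s := by
  rw [L2.inner_def]
  refine integral_congr_ae ?_
  filter_upwards [φ.coeFn_toLp 2 volume] with s hs
  rw [hs, RCLike.inner_apply, mul_comm]

lemma integrable_conj_mul (u : L2) (φ : 𝓢(ℝ, ℂ)) :
    Integrable fun s => starRingEnd ℂ (u s) * φ s := by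
  refine (L2.integrable_inner (𝕜 := ℂ) u (φ.toLp 2)).congr ?_
  filter_upwards [φ.coeFn_toLp 2 volume] with s hs
  rw [hs, RCLike.inner_apply, mul_comm]

lemma hasDerivAt_inner_gaussS (u : L2) (ξ : ℝ) :
    HasDerivAt (fun ξ => ⟪u, (gaussS ξ).toLp 2⟫_ℂ)
      (Complex.I * ⟪u, (posS (gaussS ξ)).toLp 2⟫_ℂ) ξ := by
  simp_rw [inner_toLp_eq]
  rw [← integral_const_mul]
  have hint := (integrable_conj_mul u (posS (gaussS ξ)))
  refine (hasDerivAt_integral_of_dominated_loc_of_deriv_le (s := Set.univ) (x₀ := ξ)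
    (F' := fun ξ s => Complex.I * (starRingEnd ℂ (u s) * posS (gaussS ξ) s))
    (bound := fun s => ‖starRingEnd ℂ (u s) * posS (gaussS ξ) s‖) Filter.univ_mem
    (.of_forall fun η => (integrable_conj_mul u (gaussS η)).aestronglyMeasurable)
    (integrable_conj_mul u (gaussS ξ)) (hint.const_mul _).aestronglyMeasurable
    (.of_forall fun s η _ => ?_) hint.norm (.of_forall fun s η _ => ?_)).2
  · simp only [norm_mul, Complex.norm_I, one_mul, posS_apply, gaussS_apply, norm_gauss, le_refl]
  · simp only [posS_apply, gaussS_apply]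
    have h1 : HasDerivAt (fun z : ℂ => Complex.exp (-(s : ℂ) ^ 2 / 2 + Complex.I * z * s))
        (Complex.exp (-(s : ℂ) ^ 2 / 2 + Complex.I * η * s) * (Complex.I * s)) (η : ℂ) := by
      have := (((hasDerivAt_id (η : ℂ)).const_mul Complex.I).mul_const (s : ℂ)).const_add
        (-(s : ℂ) ^ 2 / 2) |>.cexp
      simpa using this
    convert! h1.comp_ofReal.const_mul (starRingEnd ℂ (u s)) using 1
    ring

lemma eq_zero_of_inner_gaussS (u : L2) (h : ∀ ξ, ⟪u, (gaussS ξ).toLp 2⟫_ℂ = 0) : u = 0 := by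
  set f : ℝ → ℂ := fun s => starRingEnd ℂ (u s) * gaussS 0 s with hf
  have hfi : Integrable f := integrable_conj_mul u (gaussS 0)
  have hF : ∀ w : ℝ, VectorFourier.fourierIntegral Real.fourierChar volume (innerₗ ℝ) f w = 0 := by
    intro w
    have h1 := h (-2 * Real.pi * w)
    rw [inner_toLp_eq] at h1
    rw [VectorFourier.fourierIntegral, ← h1]
    congr 1; ext s
    rw [Circle.smul_def, Real.fourierChar_apply, hf]
    simp only [gaussS_apply, smul_eq_mul]
    rw [mul_left_comm, ← Complex.exp_add]
    congr 2
    simp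
    ring
  have hz : ∀ᵐ s, f s = 0 := by
    refine ae_eq_zero_of_integral_contDiff_smul_eq_zero hfi.locallyIntegrable fun g hg hgc => ?_
    have hgc' : HasCompactSupport fun s => (g s : ℂ) := hgc.comp_left Complex.ofReal_zero
    have hg' : ContDiff ℝ (⊤ : ℕ∞) fun s => (g s : ℂ) := Complex.ofRealCLM.contDiff.comp hg
    set ψ : 𝓢(ℝ, ℂ) := hgc'.toSchwartzMap hg'
    have h1 := VectorFourier.integral_fourierIntegral_smul_eq_flip (L := innerₗ ℝ)
      Real.continuous_fourierChar continuous_inner hfi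
      (SchwartzMap.integrable (μ := volume) (FourierTransform.fourierInv ψ : 𝓢(ℝ, ℂ)))
    simp only [hF, zero_smul, integral_zero] at h1
    rw [flip_innerₗ] at h1
    have h2 : ∀ s, VectorFourier.fourierIntegral Real.fourierChar volume (innerₗ ℝ)
        (FourierTransform.fourierInv ψ : 𝓢(ℝ, ℂ)) s = g s := by
      intro s
      have : FourierTransform.fourier (FourierTransform.fourierInv ψ) = ψ :=
        FourierTransform.fourier_fourierInv_eq ψ
      exact congrArg (fun χ : 𝓢(ℝ, ℂ) => χ s) this
    rw [h1]
    congr 1; ext s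
    rw [h2, smul_eq_mul, mul_comm]
    simp
  rw [Lp.eq_zero_iff_ae_eq_zero]
  filter_upwards [hz] with s hs
  rw [hf] at hs
  simpa [gaussS_apply] using hs

lemma inner_embS_single (u : H) (i : SignType × Fin 2) (φ : 𝓢(ℝ, ℂ)) :
    ⟪u, embS (Pi.single i φ)⟫_ℂ = ⟪u i, φ.toLp 2⟫_ℂ := by
  rw [PiLp.inner_apply, Finset.sum_eq_single i]
  · rw [embS_apply, Pi.single_eq_same]
  · intro j _ hj
    rw [embS_apply, Pi.single_eq_of_ne hj]
    exact inner_zero_right _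
  · simp

lemma diracS_single_zero (ν : SignType) (φ : 𝓢(ℝ, ℂ)) :
    diracS (Pi.single (ν, 0) φ) = Pi.single (ν, 1) (posS φ + Complex.I • momS φ) := by
  funext ⟨μ, j⟩
  by_cases h : μ = ν
  · subst h
    fin_cases j
    · simp [diracS_zero]
    · simp [diracS_one]
  · fin_cases j
    · simp [diracS_zero, h]
    · simp [diracS_one, h]

lemma diracS_single_one (ν : SignType) (φ : 𝓢(ℝ, ℂ)) :
    diracS (Pi.single (ν, 1) φ) = Pi.single (ν, 0) (posS φ - Complex.I • momS φ) := by
  funext ⟨μ, j⟩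
  by_cases h : μ = ν
  · subst h
    fin_cases j
    · simp [diracS_zero]
    · simp [diracS_one]
  · fin_cases j
    · simp [diracS_zero, h]
    · simp [diracS_one, h]

lemma deficiency_diracCore {c : ℂ} (hc : c * c = -1) (u : H)
    (hu : ∀ x : diracCore.domain, ⟪u, diracCore x + c • (x : H)⟫_ℂ = 0) : u = 0 := by
  have hu' : ∀ φ, ⟪u, embS (diracS φ)⟫_ℂ + c * ⟪u, embS φ⟫_ℂ = 0 := by
    intro φ
    have := hu ⟨embS φ, LinearMap.mem_range_self embS φ⟩
    rwa [diracCore_apply, inner_add_right, inner_smul_right] at this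
  have key : ∀ ν : SignType, u (ν, 0) = 0 ∧ u (ν, 1) = 0 := by
    intro ν
    set G₀ : ℝ → ℂ := fun ξ => ⟪u (ν, 0), (gaussS ξ).toLp 2⟫_ℂ with hG₀
    set G₁ : ℝ → ℂ := fun ξ => ⟪u (ν, 1), (gaussS ξ).toLp 2⟫_ℂ with hG₁
    have hd₀ : ∀ ξ, HasDerivAt G₀ _ ξ := hasDerivAt_inner_gaussS (u (ν, 0))
    have hd₁ : ∀ ξ, HasDerivAt G₁ _ ξ := hasDerivAt_inner_gaussS (u (ν, 1))
    have eq₁ : ∀ ξ : ℝ, Complex.I * ξ * G₁ ξ + c * G₀ ξ = 0 := by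
      intro ξ
      have := hu' (Pi.single (ν, 0) (gaussS ξ))
      rw [diracS_single_zero, inner_embS_single, inner_embS_single, momS_gaussS] at this
      simp only [toLp_add', toLp_smul', inner_add_right, inner_smul_right, smul_add] at this
      linear_combination this - ⟪u (ν, 1), (posS (gaussS ξ)).toLp 2⟫_ℂ * Complex.I_mul_I
    have eq₂ : ∀ ξ : ℝ, 2 * ⟪u (ν, 0), (posS (gaussS ξ)).toLp 2⟫_ℂ - Complex.I * ξ * G₀ ξ
        + c * G₁ ξ = 0 := by
      intro ξ
      have := hu' (Pi.single (ν, 1) (gaussS ξ))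
      rw [diracS_single_one, inner_embS_single, inner_embS_single, momS_gaussS] at this
      simp only [toLp_add', toLp_sub', toLp_smul', inner_add_right, inner_sub_right,
        inner_smul_right, smul_add] at this
      linear_combination this + ⟪u (ν, 0), (posS (gaussS ξ)).toLp 2⟫_ℂ * Complex.I_mul_I
    have hW : ∀ ξ : ℝ, HasDerivAt (fun ξ : ℝ => ((ξ : ℂ) * Complex.exp ((ξ : ℂ) ^ 2 / 2)) *
        (G₀ ξ * G₀ ξ)) 0 ξ := by
      intro ξ
      have h1 : HasDerivAt (fun z : ℂ => z * Complex.exp (z ^ 2 / 2))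
          (1 * Complex.exp ((ξ : ℂ) ^ 2 / 2) + ξ * (Complex.exp ((ξ : ℂ) ^ 2 / 2) * ξ)) (ξ : ℂ) := by
        have := (((hasDerivAt_id (ξ : ℂ)).pow 2).div_const 2).cexp
        refine (hasDerivAt_id (ξ : ℂ)).mul (this.congr_deriv ?_)
        simp
      refine (h1.comp_ofReal.mul ((hd₀ ξ).mul (hd₀ ξ))).congr_deriv ?_
      simp only [Pi.mul_apply]
      linear_combination (Complex.exp ((ξ : ℂ) ^ 2 / 2) * G₀ ξ) * (Complex.I * ξ * eq₂ ξ - c * eq₁ ξ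
        + G₀ ξ * hc + ξ ^ 2 * G₀ ξ * Complex.I_mul_I)
    have hconst : ∀ ξ : ℝ, ((ξ : ℂ) * Complex.exp ((ξ : ℂ) ^ 2 / 2)) * (G₀ ξ * G₀ ξ) = 0 := by
      intro ξ
      have := is_const_of_deriv_eq_zero (fun ξ => (hW ξ).differentiableAt)
        (fun ξ => (hW ξ).deriv) ξ 0
      simpa using this
    have hz₀ : ∀ ξ : ℝ, ξ ≠ 0 → G₀ ξ = 0 := by
      intro ξ hξ
      simpa [hξ, Complex.exp_ne_zero] using hconst ξ
    have hz₁ : ∀ ξ : ℝ, ξ ≠ 0 → G₁ ξ = 0 := by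
      intro ξ hξ
      simpa [hz₀ ξ hξ, hξ] using eq₁ ξ
    have ext0 : ∀ G : ℝ → ℂ, Continuous G → (∀ ξ, ξ ≠ 0 → G ξ = 0) → ∀ ξ, G ξ = 0 := by
      intro G hG h ξ
      have hden : Dense ({0}ᶜ : Set ℝ) := dense_compl_singleton 0
      exact congrFun (hG.ext_on hden continuous_const fun x hx => h x hx) ξ
    exact ⟨eq_zero_of_inner_gaussS _ (ext0 G₀
        (continuous_iff_continuousAt.2 fun ξ => (hd₀ ξ).continuousAt) hz₀),
      eq_zero_of_inner_gaussS _ (ext0 G₁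
        (continuous_iff_continuousAt.2 fun ξ => (hd₁ ξ).continuousAt) hz₁)⟩
  ext1 ⟨ν, j⟩
  fin_cases j
  · exact (key ν).1
  · exact (key ν).2

/-- The Dirac operator is self-adjoint. -/
theorem isSelfAdjoint_dirac : IsSelfAdjoint dirac := by
  refine isSelfAdjoint_closure dense_diracCore ?_
    (deficiency_diracCore Complex.I_mul_I) (deficiency_diracCore (by simp))
  rintro ⟨_, φ, rfl⟩ ⟨_, ψ, rfl⟩
  have h1 := diracCore_apply φ
  have h2 := diracCore_apply ψ
  rw [h1, h2]
  exact inner_diracS φ ψ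

end SelfAdjoint

end KappaAffine

end

noncomputable section

namespace KappaAffine

/-! ### Hilbert–Schmidt norms, positive square roots and a criterion for trace class -/

section Hilbert

variable {E : Type*} [NormedAddCommGroup E] [InnerProductSpace ℂ E]

/-! On each spinor component `𝒟²` is the harmonic oscillator `s² - d²/ds²` shifted by `∓1`. The
Hermite functions `hₙ`, placed in the six components, therefore form a Hilbert basis of eigenvectors
of `(1 + 𝒟²)^(-1/2)`, with eigenvalues `(2n + 1 + 2j)^(-1/2)` for `j = 0, 1`
(`invSqrtOneAddSq_hermiteH`, `hermiteBasis`). A bounded operator is trace class as soon as the norms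
of its values on one Hilbert basis are summable (`isTraceClass_of_summable_norm`), so it suffices
that the commutator has norm `O(n^(-5/4))` on `hₙ`. This exponent is a sum of two gains.

A factor `n⁻¹` comes from commuting. Multiplication by `s` and `d/ds` can be moved across `π_ν(f)`
at the price of changing `f` within the algebra, so the commutator of the oscillator with `π_ν(f)`
has the form `lowering ∘ π_ν(g₁) + π_ν(g₂)` (`exists_inner_oscS_commutator`). In the Hermite basis
this controls `(λₘ - λₙ)⟪hₘ, π_ν(f) hₙ⟫`, with `λₙ = 2n + 1`. The difference of the eigenvalues of
`(1 + 𝒟²)^(-1/2)` is at most `λₙ⁻¹ λₘ^(-1/2) |λₘ - λₙ|`, and `λₘ^(-1/2)` absorbs the growth of the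
ladder operator. Bessel's inequality in `m` leaves `λₙ⁻¹ (‖π_ν(g₁) hₙ‖ + ‖π_ν(g₂) hₙ‖)` up to
constants.

A factor `n^(-1/4)` comes from decay of `‖π_ν(g) hₙ‖` (`exists_norm_rep_hermiteS_le`). Since
`π_ν(g)` absorbs derivatives on its right, it only sees low frequencies (`exists_norm_rep_le`). The
Fourier transform of `hₙ` is again an oscillator eigenfunction up to scaling, spread over a range of
length of order `√n`, and a virial argument bounds its mass near the origin by `O(n^(-1/2))`
(`integral_norm_sq_div_le`). -/

lemma inner_self_eq_ofReal (x : E) : ⟪x, x⟫_ℂ = ((‖x‖ ^ 2 : ℝ) : ℂ) := by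
  rw [inner_self_eq_norm_sq_to_K]
  norm_cast

lemma hasSum_norm_sq_inner {ι : Type*} (e : HilbertBasis ι ℂ E) (x : E) :
    HasSum (fun i => ‖⟪e i, x⟫_ℂ‖ ^ 2) (‖x‖ ^ 2) := by
  have h := e.hasSum_inner_mul_inner x x
  rw [inner_self_eq_ofReal] at h
  have h2 : (fun i => ⟪x, e i⟫_ℂ * ⟪e i, x⟫_ℂ) = fun i => ((‖⟪e i, x⟫_ℂ‖ ^ 2 : ℝ) : ℂ) := by
    funext i
    rw [← inner_conj_symm x, RCLike.conj_mul]
    norm_cast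
  rw [h2] at h
  exact Complex.hasSum_ofReal.1 h

/-- Parseval in terms of finite partial sums, so that bounds on single coefficients can be combined
with the finite form of Bessel's inequality, with no summability to check. -/
lemma norm_le_of_sum_inner_le {ι : Type*} (e : HilbertBasis ι ℂ E) (x : E) {C : ℝ} (hC : 0 ≤ C)
    (h : ∀ s : Finset ι, ∑ i ∈ s, ‖⟪e i, x⟫_ℂ‖ ^ 2 ≤ C ^ 2) : ‖x‖ ≤ C :=
  (sq_le_sq₀ (norm_nonneg _) hC).1 (hasSum_le_of_sum_le (hasSum_norm_sq_inner e x) h)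

lemma tsum_ofReal_norm_sq_inner {ι : Type*} (e : HilbertBasis ι ℂ E) (x : E) :
    ∑' i, ENNReal.ofReal (‖⟪e i, x⟫_ℂ‖ ^ 2) = ENNReal.ofReal (‖x‖ ^ 2) := by
  have h := hasSum_norm_sq_inner e x
  rw [← h.tsum_eq, ENNReal.ofReal_tsum_of_nonneg (fun _ => by positivity) h.summable]

variable [CompleteSpace E]

/-- The Hilbert–Schmidt norm of a self-adjoint operator does not depend on the basis. -/
lemma tsum_norm_sq_eq {ι κ : Type*} (e : HilbertBasis ι ℂ E) (b : HilbertBasis κ ℂ E)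
    {R : E →L[ℂ] E} (hR : IsSelfAdjoint R) :
    ∑' i, ENNReal.ofReal (‖R (e i)‖ ^ 2) = ∑' k, ENNReal.ofReal (‖R (b k)‖ ^ 2) := by
  -- By Parseval both sides become double sums of squared matrix coefficients. In `[0, ∞]` the order
  -- of summation can be exchanged even when the value is infinite.
  simp_rw [← tsum_ofReal_norm_sq_inner b (R (e _)), ← tsum_ofReal_norm_sq_inner e (R (b _))]
  rw [ENNReal.tsum_comm]
  congr 1; ext k; congr 1; ext i
  have : ⟪R (b k), e i⟫_ℂ = ⟪b k, R (e i)⟫_ℂ := hR.isSymmetric _ _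
  rw [← this, ← inner_conj_symm, RCLike.norm_conj]

lemma norm_abs_apply (A : E →L[ℂ] E) (x : E) : ‖CFC.abs A x‖ = ‖A x‖ := by
  have hs : IsSelfAdjoint (CFC.abs A) := (CFC.abs_nonneg A).isSelfAdjoint
  have h : ⟪CFC.abs A x, CFC.abs A x⟫_ℂ = ⟪A x, A x⟫_ℂ := by
    have h1 : ⟪CFC.abs A x, CFC.abs A x⟫_ℂ = ⟪x, (CFC.abs A * CFC.abs A) x⟫_ℂ :=
      hs.isSymmetric _ _
    rw [h1, CFC.abs_mul_abs]
    exact ContinuousLinearMap.adjoint_inner_right A x (A x)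
  rw [inner_self_eq_ofReal, inner_self_eq_ofReal] at h
  have h' : ‖CFC.abs A x‖ ^ 2 = ‖A x‖ ^ 2 := by exact_mod_cast h
  exact (sq_eq_sq₀ (norm_nonneg _) (norm_nonneg _)).1 h'

lemma inner_nonneg_operator {P : E →L[ℂ] E} (hP : 0 ≤ P) (x : E) :
    ⟪x, P x⟫_ℂ = ((‖CFC.sqrt P x‖ ^ 2 : ℝ) : ℂ) := by
  have hs : IsSelfAdjoint (CFC.sqrt P) := (CFC.sqrt_nonneg P).isSelfAdjoint
  have h1 : ⟪CFC.sqrt P x, CFC.sqrt P x⟫_ℂ = ⟪x, (CFC.sqrt P * CFC.sqrt P) x⟫_ℂ :=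
    hs.isSymmetric _ _
  rw [CFC.sqrt_mul_sqrt_self P hP] at h1
  rw [← h1, inner_self_eq_ofReal]

/-- The square root of a positive operator on an eigenvector. -/
lemma sqrt_apply_eigenvector {A : E →L[ℂ] E} (hA : 0 ≤ A) {x : E} {μ : ℝ} (hμ : 0 < μ)
    (h : A x = ((μ ^ 2 : ℝ) : ℂ) • x) : CFC.sqrt A x = (μ : ℂ) • x := by
  set S := CFC.sqrt A with hS
  have hSS : S (S x) = ((μ ^ 2 : ℝ) : ℂ) • x := by
    rw [← h, ← CFC.sqrt_mul_sqrt_self A hA]; rfl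
  set y := S x - (μ : ℂ) • x with hy
  -- This is `(S + μ)(S - μ)x = 0`. A positive operator has no eigenvector for `-μ < 0`, so `y`
  -- vanishes.
  have hSy : S y = -(μ : ℂ) • y := by
    rw [hy, map_sub, hSS, map_smul, smul_sub, smul_smul]
    push_cast
    rw [neg_mul, neg_smul, neg_smul, sq]
    abel
  have h1 := inner_nonneg_operator (CFC.sqrt_nonneg A) y
  rw [← hS, hSy, inner_smul_right, inner_self_eq_ofReal] at h1
  have h2 : -μ * ‖y‖ ^ 2 = ‖CFC.sqrt S y‖ ^ 2 := by exact_mod_cast h1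
  have h3 : ‖y‖ ^ 2 = 0 := by nlinarith [sq_nonneg ‖y‖, sq_nonneg ‖CFC.sqrt S y‖]
  have h4 : y = 0 := by simpa using h3
  exact sub_eq_zero.1 h4

end Hilbert

/-- An operator whose values on some Hilbert basis are absolutely summable is trace class. -/
lemma isTraceClass_of_summable_norm {F : Type*} [NormedAddCommGroup F] [InnerProductSpace ℂ F]
    [CompleteSpace F] {κ : Type*} (e : HilbertBasis κ ℂ F) (A : F →L[ℂ] F)
    (h : Summable fun k => ‖A (e k)‖) : IsTraceClass A := by
  intro ι b
  set P := CFC.abs A with hP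
  have hP0 : 0 ≤ P := CFC.abs_nonneg A
  have hs : IsSelfAdjoint (CFC.sqrt P) := (CFC.sqrt_nonneg P).isSelfAdjoint
  simp_rw [inner_nonneg_operator hP0, Complex.ofReal_re]
  -- The trace of `P` is the squared Hilbert–Schmidt norm of its square root, which allows the
  -- passage from the arbitrary basis `b` to `e`.
  have h1 := tsum_norm_sq_eq b e hs
  have h2 : ∑' k, ENNReal.ofReal (‖CFC.sqrt P (e k)‖ ^ 2) ≤ ∑' k, ENNReal.ofReal ‖A (e k)‖ := by
    refine ENNReal.tsum_le_tsum fun k => ENNReal.ofReal_le_ofReal ?_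
    have h3 := inner_nonneg_operator hP0 (e k)
    have h4 : ‖⟪e k, P (e k)⟫_ℂ‖ = ‖CFC.sqrt P (e k)‖ ^ 2 := by
      rw [h3, Complex.norm_real, Real.norm_of_nonneg (by positivity)]
    rw [← h4, ← norm_abs_apply A]
    refine (norm_inner_le_norm _ _).trans ?_
    rw [e.orthonormal.1 k, one_mul]
  rw [← ENNReal.ofReal_tsum_of_nonneg (fun _ => norm_nonneg _) h] at h2
  have h5 : ∑' i, ENNReal.ofReal (‖CFC.sqrt P (b i)‖ ^ 2) ≠ ⊤ := by
    rw [h1]; exact (h2.trans_lt ENNReal.ofReal_lt_top).ne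
  have h6 := ENNReal.summable_toReal h5
  simpa using h6

/-! ### Ladder operators and the Hermite basis of `L²(ℝ)` -/

section Oscillator

/-- The inclusion of Schwartz space in `L²(ℝ)`. -/
def toL2 : 𝓢(ℝ, ℂ) →ₗ[ℂ] L2 := (SchwartzMap.toLpCLM ℂ ℂ 2 (volume : Measure ℝ)).toLinearMap

lemma toL2_def (φ : 𝓢(ℝ, ℂ)) : toL2 φ = φ.toLp 2 := rfl

lemma coeFn_toL2 (φ : 𝓢(ℝ, ℂ)) : toL2 φ =ᵐ[volume] φ := φ.coeFn_toLp 2 volume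

lemma toL2_injective : Function.Injective toL2 := SchwartzMap.injective_toLp 2 (volume : Measure ℝ)

/-- The derivative on Schwartz functions. -/
def derS : 𝓢(ℝ, ℂ) →ₗ[ℂ] 𝓢(ℝ, ℂ) := (SchwartzMap.derivCLM ℂ ℂ).toLinearMap

lemma derS_apply (φ : 𝓢(ℝ, ℂ)) (s : ℝ) : derS φ s = deriv φ s := rfl

lemma momS_eq (φ : 𝓢(ℝ, ℂ)) : momS φ = -Complex.I • derS φ := rfl

lemma hasDerivAt_schwartz (φ : 𝓢(ℝ, ℂ)) (s : ℝ) : HasDerivAt φ (derS φ s) s := φ.hasDerivAt s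

lemma inner_derS (φ ψ : 𝓢(ℝ, ℂ)) : ⟪toL2 (derS φ), toL2 ψ⟫_ℂ = -⟪toL2 φ, toL2 (derS ψ)⟫_ℂ := by
  have h := inner_momS φ ψ
  rw [momS_eq, momS_eq, toLp_smul', toLp_smul', inner_smul_left, inner_smul_right] at h
  simp only [map_neg, Complex.conj_I, ← toL2_def] at h
  linear_combination (-Complex.I) * h + (⟪toL2 (derS φ), toL2 ψ⟫_ℂ
    + ⟪toL2 φ, toL2 (derS ψ)⟫_ℂ) * Complex.I_mul_I

lemma derS_posS (φ : 𝓢(ℝ, ℂ)) : derS (posS φ) = φ + posS (derS φ) := by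
  ext s
  have h1 : (posS φ : ℝ → ℂ) = fun s : ℝ => (s : ℂ) * φ s := funext (posS_apply φ)
  have h2 : HasDerivAt (fun s : ℝ => (s : ℂ) * φ s) (1 * φ s + s * derS φ s) s :=
    (Complex.ofRealCLM.hasDerivAt (x := s)).mul (hasDerivAt_schwartz φ s)
  rw [derS_apply, h1, h2.deriv, add_apply, posS_apply, one_mul]

/-- The harmonic oscillator `s² - d²/ds²`. -/
def oscS : 𝓢(ℝ, ℂ) →ₗ[ℂ] 𝓢(ℝ, ℂ) := posS ∘ₗ posS - derS ∘ₗ derS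

/-- The creation operator `s - d/ds`. -/
def raiseS : 𝓢(ℝ, ℂ) →ₗ[ℂ] 𝓢(ℝ, ℂ) := posS - derS

/-- The annihilation operator `s + d/ds`. -/
def lowerS : 𝓢(ℝ, ℂ) →ₗ[ℂ] 𝓢(ℝ, ℂ) := posS + derS

lemma oscS_apply (φ : 𝓢(ℝ, ℂ)) : oscS φ = posS (posS φ) - derS (derS φ) := rfl

lemma raiseS_apply (φ : 𝓢(ℝ, ℂ)) : raiseS φ = posS φ - derS φ := rfl

lemma lowerS_apply (φ : 𝓢(ℝ, ℂ)) : lowerS φ = posS φ + derS φ := rfl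

/-- This factorization and the next rest on `[d/ds, s] = 1`. They are also the two diagonal blocks
of `𝒟²`. -/
lemma lowerS_raiseS (φ : 𝓢(ℝ, ℂ)) : lowerS (raiseS φ) = oscS φ + φ := by
  simp only [oscS_apply, raiseS_apply, lowerS_apply, map_sub, derS_posS]
  abel

lemma raiseS_lowerS (φ : 𝓢(ℝ, ℂ)) : raiseS (lowerS φ) = oscS φ - φ := by
  simp only [oscS_apply, raiseS_apply, lowerS_apply, map_add, derS_posS]
  abel

/-- Computing `raiseS (lowerS (raiseS φ))` through either factorization gives the two sides. -/
lemma oscS_raiseS (φ : 𝓢(ℝ, ℂ)) : oscS (raiseS φ) = raiseS (oscS φ) + (2 : ℂ) • raiseS φ := by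
  have h := raiseS_lowerS (raiseS φ)
  rw [lowerS_raiseS, map_add] at h
  rw [two_smul, ← add_assoc, h, sub_add_cancel]

lemma inner_raiseS (φ ψ : 𝓢(ℝ, ℂ)) :
    ⟪toL2 (raiseS φ), toL2 ψ⟫_ℂ = ⟪toL2 φ, toL2 (lowerS ψ)⟫_ℂ := by
  have h : ⟪toL2 (posS φ), toL2 ψ⟫_ℂ = ⟪toL2 φ, toL2 (posS ψ)⟫_ℂ := inner_posS φ ψ
  rw [raiseS_apply, lowerS_apply, map_sub, map_add, inner_sub_left, inner_add_right, h, inner_derS]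
  ring

lemma inner_oscS (φ ψ : 𝓢(ℝ, ℂ)) :
    ⟪toL2 (oscS φ), toL2 ψ⟫_ℂ = ⟪toL2 φ, toL2 (oscS ψ)⟫_ℂ := by
  have h : ∀ φ ψ, ⟪toL2 (posS φ), toL2 ψ⟫_ℂ = ⟪toL2 φ, toL2 (posS ψ)⟫_ℂ := inner_posS
  simp only [oscS_apply, map_sub, inner_sub_left, inner_sub_right, h, inner_derS, neg_neg]

lemma lowerS_gaussS_zero : lowerS (gaussS 0) = 0 := by
  ext s
  have h := (hasDerivAt_gauss 0 s).deriv
  have h2 : derS (gaussS 0) s = _ := h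
  rw [lowerS_apply, add_apply, h2, posS_apply, gaussS_apply]
  simp

lemma gaussS_ne_zero : gaussS 0 ≠ 0 := by
  intro h
  have := congrArg (fun φ : 𝓢(ℝ, ℂ) => φ 0) h
  simp [gaussS_apply] at this

/-- The normalized Hermite functions. -/
def hermiteS : ℕ → 𝓢(ℝ, ℂ)
  | 0 => ((‖toL2 (gaussS 0)‖⁻¹ : ℝ) : ℂ) • gaussS 0
  | n + 1 => (((√(2 * n + 2))⁻¹ : ℝ) : ℂ) • raiseS (hermiteS n)

lemma raiseS_hermiteS (n : ℕ) :
    raiseS (hermiteS n) = ((√(2 * n + 2) : ℝ) : ℂ) • hermiteS (n + 1) := by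
  rw [hermiteS, smul_smul, ← Complex.ofReal_mul, mul_inv_cancel₀ (by positivity), Complex.ofReal_one,
    one_smul]

lemma lowerS_hermiteS_zero : lowerS (hermiteS 0) = 0 := by
  rw [hermiteS, map_smul, lowerS_gaussS_zero, smul_zero]

lemma oscS_hermiteS (n : ℕ) : oscS (hermiteS n) = ((2 * n + 1 : ℝ) : ℂ) • hermiteS n := by
  induction n with
  | zero =>
    have h := raiseS_lowerS (hermiteS 0)
    rw [lowerS_hermiteS_zero, map_zero] at h
    simpa using (sub_eq_zero.1 h.symm)
  | succ n ih =>
    rw [hermiteS, map_smul, oscS_raiseS, ih, map_smul, ← add_smul, smul_comm]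
    congr 2
    push_cast
    ring

lemma lowerS_raiseS_hermiteS (n : ℕ) :
    lowerS (raiseS (hermiteS n)) = ((2 * n + 2 : ℝ) : ℂ) • hermiteS n := by
  rw [lowerS_raiseS, oscS_hermiteS]
  nth_rw 2 [← one_smul ℂ (hermiteS n)]
  rw [← add_smul]
  congr 1
  push_cast
  ring

lemma lowerS_hermiteS_succ (n : ℕ) :
    lowerS (hermiteS (n + 1)) = ((√(2 * n + 2) : ℝ) : ℂ) • hermiteS n := by
  rw [hermiteS, map_smul, lowerS_raiseS_hermiteS, smul_smul, ← Complex.ofReal_mul]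
  congr 2
  rw [inv_mul_eq_div, Real.div_sqrt]

lemma norm_hermiteS (n : ℕ) : ‖toL2 (hermiteS n)‖ = 1 := by
  induction n with
  | zero =>
    have h : toL2 (gaussS 0) ≠ 0 := fun h =>
      gaussS_ne_zero (toL2_injective (h.trans (map_zero toL2).symm))
    rw [hermiteS, map_smul, norm_smul, Complex.norm_real, norm_inv, norm_norm,
      inv_mul_cancel₀ (norm_ne_zero_iff.2 h)]
  | succ n ih =>
    -- `raiseS` is the formal adjoint of `lowerS`, so `‖raiseS hₙ‖² = ⟪hₙ, lowerS (raiseS hₙ)⟫ = 2n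
    -- + 2`.
    have h1 := inner_raiseS (hermiteS n) (raiseS (hermiteS n))
    rw [lowerS_raiseS_hermiteS, map_smul, inner_smul_right, inner_self_eq_ofReal,
      inner_self_eq_ofReal, ih] at h1
    have h2 : ‖toL2 (raiseS (hermiteS n))‖ ^ 2 = 2 * n + 2 := by
      rw [← Complex.ofReal_mul] at h1
      simpa using Complex.ofReal_injective h1
    rw [hermiteS, map_smul, norm_smul, Complex.norm_real, Real.norm_of_nonneg (by positivity), ← h2,
      Real.sqrt_sq (norm_nonneg _), inv_mul_cancel₀]
    intro h3
    rw [h3] at h2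
    norm_num at h2
    linarith [(Nat.cast_nonneg n : (0 : ℝ) ≤ n)]

lemma orthonormal_hermiteS : Orthonormal ℂ fun n => toL2 (hermiteS n) := by
  refine ⟨norm_hermiteS, fun n m hnm => ?_⟩
  -- Eigenvectors of a symmetric operator for distinct eigenvalues are orthogonal.
  have h := inner_oscS (hermiteS n) (hermiteS m)
  rw [oscS_hermiteS, oscS_hermiteS, map_smul, map_smul, inner_smul_left, inner_smul_right,
    Complex.conj_ofReal] at h
  have h2 : (((2 * n + 1 : ℝ) : ℂ) - ((2 * m + 1 : ℝ) : ℂ)) ≠ 0 := by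
    rw [← Complex.ofReal_sub, Complex.ofReal_ne_zero]
    intro h3
    have : (n : ℝ) = m := by linarith
    exact hnm (by exact_mod_cast this)
  exact (mul_eq_zero.1 (by rw [sub_mul, h, sub_self])).resolve_left h2

/-- Multiplication by `s` is half the sum of the two ladder operators. Iterating it on `h₀` shows
that the span contains every `sᵏ exp(-s²/2)`. -/
lemma posS_mem_span_hermiteS {φ : 𝓢(ℝ, ℂ)} (h : φ ∈ Submodule.span ℂ (Set.range hermiteS)) :
    posS φ ∈ Submodule.span ℂ (Set.range hermiteS) := by
  have hpos : ∀ φ, posS φ = (2⁻¹ : ℂ) • (raiseS φ + lowerS φ) := by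
    intro φ
    rw [raiseS_apply, lowerS_apply, sub_add_add_cancel, ← two_smul ℂ, smul_smul]
    norm_num
  have hm : ∀ n, hermiteS n ∈ Submodule.span ℂ (Set.range hermiteS) := fun n =>
    Submodule.subset_span ⟨n, rfl⟩
  have hle : (Submodule.span ℂ (Set.range hermiteS)).map posS ≤
      Submodule.span ℂ (Set.range hermiteS) := by
    rw [Submodule.map_span_le]
    rintro _ ⟨n, rfl⟩
    rw [hpos]
    refine Submodule.smul_mem _ _ (Submodule.add_mem _ ?_ ?_)
    · rw [raiseS_hermiteS]
      exact Submodule.smul_mem _ _ (hm _)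
    · cases n with
      | zero => rw [lowerS_hermiteS_zero]; exact Submodule.zero_mem _
      | succ n => rw [lowerS_hermiteS_succ]; exact Submodule.smul_mem _ _ (hm _)
  exact hle (Submodule.mem_map_of_mem h)

lemma inner_posS_iterate_gaussS_eq_zero {u : L2} (h : ∀ n, ⟪u, toL2 (hermiteS n)⟫_ℂ = 0) (k : ℕ) :
    ⟪u, toL2 (posS^[k] (gaussS 0))⟫_ℂ = 0 := by
  have h1 : posS^[k] (gaussS 0) ∈ Submodule.span ℂ (Set.range hermiteS) := by
    induction k with
    | zero =>
      have h2 : hermiteS 0 ∈ Submodule.span ℂ (Set.range hermiteS) := Submodule.subset_span ⟨0, rfl⟩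
      rw [hermiteS, Submodule.smul_mem_iff] at h2
      · exact h2
      · rw [Complex.ofReal_ne_zero]
        refine inv_ne_zero (norm_ne_zero_iff.2 fun h => ?_)
        exact gaussS_ne_zero (toL2_injective (h.trans (map_zero toL2).symm))
    | succ k ih =>
      rw [Function.iterate_succ_apply']
      exact posS_mem_span_hermiteS ih
  generalize posS^[k] (gaussS 0) = φ at h1
  induction h1 using Submodule.span_induction with
  | mem x hx => obtain ⟨n, rfl⟩ := hx; exact h n
  | zero => simp
  | add x y _ _ hx hy => rw [map_add, inner_add_right, hx, hy, add_zero]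
  | smul a x _ hx => rw [map_smul, inner_smul_right, hx, mul_zero]

lemma posS_iterate_apply (k : ℕ) (φ : 𝓢(ℝ, ℂ)) (s : ℝ) : posS^[k] φ s = (s : ℂ) ^ k * φ s := by
  induction k with
  | zero => simp
  | succ k ih => rw [Function.iterate_succ_apply', posS_apply, ih]; ring

lemma memLp_gaussian {b : ℝ} (hb : 0 < b) : MemLp (fun s : ℝ => Real.exp (-b * s ^ 2)) 2 volume := by
  rw [memLp_two_iff_integrable_sq (by fun_prop)]
  refine (integrable_exp_neg_mul_sq (b := 2 * b) (by positivity)).congr (.of_forall fun s => ?_)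
  simp only
  rw [← Real.exp_nat_mul]
  congr 1
  push_cast
  ring

/-- Completeness. A vector orthogonal to all `sᵏ exp(-s²/2)` is orthogonal to each wave packet
`exp(-s²/2 + iξs)`, by expanding `exp(iξs)` in powers of `s` and integrating termwise. These packets
separate `L²(ℝ)` by Fourier uniqueness. -/
lemma eq_zero_of_inner_hermiteS {u : L2} (h : ∀ n, ⟪u, toL2 (hermiteS n)⟫_ℂ = 0) : u = 0 := by
  refine eq_zero_of_inner_gaussS u fun ξ => ?_
  rw [inner_toLp_eq]
  have hterm : ∀ k : ℕ, ∫ s, (Complex.I * ξ) ^ k / k.factorial *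
      (starRingEnd ℂ (u s) * posS^[k] (gaussS 0) s) = 0 := by
    intro k
    rw [integral_const_mul, ← inner_toLp_eq, ← toL2_def, inner_posS_iterate_gaussS_eq_zero h,
      mul_zero]
  have hexp : ∀ s : ℝ, HasSum (fun k : ℕ => |ξ * s| ^ k / k.factorial) (Real.exp |ξ * s|) := by
    intro s
    rw [Real.exp_eq_exp_ℝ]
    exact NormedSpace.expSeries_div_hasSum_exp _
  have hbound : ∀ s : ℝ, HasSum (fun k : ℕ => ‖u s‖ * Real.exp (-s ^ 2 / 2) *
      (|ξ * s| ^ k / k.factorial)) (‖u s‖ * Real.exp (-s ^ 2 / 2) * Real.exp |ξ * s|) :=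
    fun s => (hexp s).mul_left _
  have hsum := hasSum_integral_of_dominated_convergence
    (F := fun (k : ℕ) (s : ℝ) => (Complex.I * ξ) ^ k / k.factorial *
      (starRingEnd ℂ (u s) * posS^[k] (gaussS 0) s))
    (f := fun s => starRingEnd ℂ (u s) * gaussS ξ s)
    (fun k s => ‖u s‖ * Real.exp (-s ^ 2 / 2) * (|ξ * s| ^ k / k.factorial))
    (fun k => ((integrable_conj_mul u _).const_mul _).aestronglyMeasurable)
    (fun k => .of_forall fun s => ?_) (.of_forall fun s => (hbound s).summable) ?_
    (.of_forall fun s => ?_)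
  · simp_rw [hterm] at hsum
    exact hsum.unique hasSum_zero
  · rw [posS_iterate_apply, gaussS_apply, norm_mul, norm_mul, norm_mul, norm_gauss, norm_div,
      norm_pow, norm_pow, norm_mul, RCLike.norm_conj, Complex.norm_I, Complex.norm_real,
      Complex.norm_real, abs_mul, mul_pow, one_pow, one_mul, Complex.norm_natCast,
      Real.norm_eq_abs, Real.norm_eq_abs]
    refine le_of_eq ?_
    ring
  · simp_rw [fun s => (hbound s).tsum_eq]
    -- From `|ξ||s| ≤ ξ² + s²/4`, the dominating sum is at most `exp(ξ²) ‖u s‖ exp(-s²/4)`, a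
    -- constant times a product of two `L²` functions.
    have h1 : Integrable fun s => ‖u s‖ * Real.exp (-(1 / 4) * s ^ 2) :=
      (Lp.memLp u).norm.integrable_mul (memLp_gaussian (by norm_num))
    refine (h1.const_mul (Real.exp (ξ ^ 2))).mono' ?_ (.of_forall fun s => ?_)
    · have := (Lp.aestronglyMeasurable u).norm
      exact (this.mul (by fun_prop)).mul (by fun_prop)
    · rw [Real.norm_of_nonneg (by positivity), mul_assoc, mul_left_comm (Real.exp (ξ ^ 2)),
        ← Real.exp_add, ← Real.exp_add]
      refine mul_le_mul_of_nonneg_left (Real.exp_le_exp.2 ?_) (norm_nonneg _)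
      rw [abs_mul]
      nlinarith [sq_nonneg (|ξ| - |s| / 2), sq_abs ξ, sq_abs s]
  · have h1 := (NormedSpace.expSeries_div_hasSum_exp (Complex.I * ξ * s)).mul_left
      (starRingEnd ℂ (u s) * gaussS 0 s)
    rw [← Complex.exp_eq_exp_ℂ] at h1
    convert! h1 using 1
    · funext k
      rw [posS_iterate_apply, mul_pow]
      ring
    · rw [mul_assoc, gaussS_apply, gaussS_apply, ← Complex.exp_add]
      congr 3
      simp

end Oscillator

/-! ### Moving `s` and `d/ds` across `π_ν(f)` -/

section Algebra

lemma inner_rep (ν : SignType) (f : smoothAlgebra) (x y : L2) :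
    ⟪x, rep ν f y⟫_ℂ = ∫ p : ℝ × ℝ, (Real.exp p.1 : ℂ) * f.1 p * ⟪x, groupRep ν p y⟫_ℂ := by
  have h := (innerSL ℂ x).integral_comp_comm (integrable_rep ν f y)
  simp only [innerSL_apply_apply, inner_smul_right] at h
  exact h.symm

/-- The pairing of Schwartz functions with the affine group, as an integral. -/
lemma inner_groupRep (ν : SignType) (p : ℝ × ℝ) (χ φ : 𝓢(ℝ, ℂ)) :
    ⟪toL2 χ, groupRep ν p (toL2 φ)⟫_ℂ = ∫ s, starRingEnd ℂ (χ s) *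
      (Complex.exp (((ν : ℝ) * p.2 * Real.exp (-s) : ℝ) * Complex.I) * φ (s + p.1)) := by
  rw [L2.inner_def]
  refine integral_congr_ae ?_
  filter_upwards [coeFn_toL2 χ, groupRep_coeFn ν p (toL2 φ),
    (measurePreserving_add_right volume p.1).quasiMeasurePreserving.ae (coeFn_toL2 φ)]
    with s h1 h2 h3
  rw [h1, h2, h3, RCLike.inner_apply, mul_comm]

lemma integrable_pairing (ν : SignType) (p : ℝ × ℝ) (χ φ : 𝓢(ℝ, ℂ)) :
    Integrable fun s => starRingEnd ℂ (χ s) *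
      (Complex.exp (((ν : ℝ) * p.2 * Real.exp (-s) : ℝ) * Complex.I) * φ (s + p.1)) := by
  refine (L2.integrable_inner (𝕜 := ℂ) (toL2 χ) (groupRep ν p (toL2 φ))).congr ?_
  filter_upwards [coeFn_toL2 χ, groupRep_coeFn ν p (toL2 φ),
    (measurePreserving_add_right volume p.1).quasiMeasurePreserving.ae (coeFn_toL2 φ)]
    with s h1 h2 h3
  rw [h1, h2, h3, RCLike.inner_apply, mul_comm]

/-- Multiplication by `s` commutes with the phase, and translation turns it into multiplication by
`s + a`. -/
lemma inner_groupRep_posS (ν : SignType) (p : ℝ × ℝ) (χ φ : 𝓢(ℝ, ℂ)) :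
    ⟪toL2 χ, groupRep ν p (toL2 (posS φ))⟫_ℂ = ⟪toL2 (posS χ), groupRep ν p (toL2 φ)⟫_ℂ +
      p.1 * ⟪toL2 χ, groupRep ν p (toL2 φ)⟫_ℂ := by
  simp_rw [inner_groupRep]
  rw [← integral_const_mul, ← integral_add (integrable_pairing ν p (posS χ) φ)
    ((integrable_pairing ν p χ φ).const_mul _)]
  congr 1; ext s
  rw [posS_apply, posS_apply, map_mul, Complex.conj_ofReal]
  push_cast
  ring

/-- Multiplication of an element of the algebra by the first coordinate. -/
def mulFst (f : smoothAlgebra) : smoothAlgebra :=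
  ⟨fun p => (p.1 : ℂ) * f.1 p, by
    have h1 := f.2.1
    have h2 : ContDiff ℝ (⊤ : ℕ∞) fun p : ℝ × ℝ => (p.1 : ℂ) :=
      Complex.ofRealCLM.contDiff.comp contDiff_fst
    exact ⟨h2.mul h1, f.2.2.mul_left⟩⟩

lemma inner_rep_posS (ν : SignType) (f : smoothAlgebra) (χ φ : 𝓢(ℝ, ℂ)) :
    ⟪toL2 χ, rep ν f (toL2 (posS φ))⟫_ℂ = ⟪toL2 (posS χ), rep ν f (toL2 φ)⟫_ℂ +
      ⟪toL2 χ, rep ν (mulFst f) (toL2 φ)⟫_ℂ := by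
  have hi : ∀ (f : smoothAlgebra) (x y : L2), Integrable fun p : ℝ × ℝ =>
      (Real.exp p.1 : ℂ) * f.1 p * ⟪x, groupRep ν p y⟫_ℂ := by
    intro f x y
    have h := (innerSL ℂ x).integrable_comp (integrable_rep ν f y)
    simpa only [innerSL_apply_apply, inner_smul_right] using h
  rw [inner_rep, inner_rep, inner_rep, ← integral_add (hi f _ _) (hi (mulFst f) _ _)]
  congr 1; ext p
  rw [inner_groupRep_posS, mulFst]
  ring

/-- The pairing is differentiable along translations. -/
lemma hasLineDerivAt_inner_groupRep (ν : SignType) (p : ℝ × ℝ) (χ φ : 𝓢(ℝ, ℂ)) :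
    HasLineDerivAt ℝ (fun p => ⟪toL2 χ, groupRep ν p (toL2 φ)⟫_ℂ)
      ⟪toL2 χ, groupRep ν p (toL2 (derS φ))⟫_ℂ p (1, 0) := by
  rw [HasLineDerivAt]
  simp_rw [inner_groupRep]
  obtain ⟨C, hC⟩ : ∃ C, ∀ s, ‖derS φ s‖ ≤ C := by
    obtain ⟨C, -, hC⟩ := (derS φ).decay 0 0
    exact ⟨C, fun s => by simpa using hC s⟩
  have key := hasDerivAt_integral_of_dominated_loc_of_deriv_le (μ := volume) (s := Set.univ)
    (x₀ := (0 : ℝ))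
    (F := fun t s => starRingEnd ℂ (χ s) * (Complex.exp (((ν : ℝ) * (p + t • ((1 : ℝ), (0 : ℝ))).2
      * Real.exp (-s) : ℝ) * Complex.I) * φ (s + (p + t • ((1 : ℝ), (0 : ℝ))).1)))
    (F' := fun t s => starRingEnd ℂ (χ s) * (Complex.exp (((ν : ℝ) * (p + t • ((1 : ℝ), (0 : ℝ))).2
      * Real.exp (-s) : ℝ) * Complex.I) * derS φ (s + (p + t • ((1 : ℝ), (0 : ℝ))).1)))
    (bound := fun s => ‖χ s‖ * C) Filter.univ_mem
    (.of_forall fun t => (integrable_pairing ν _ χ φ).aestronglyMeasurable)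
    (integrable_pairing ν _ χ φ) (integrable_pairing ν _ χ (derS φ)).aestronglyMeasurable
    (.of_forall fun s t _ => ?_) (χ.integrable.norm.mul_const C) (.of_forall fun s t _ => ?_)
  · convert! key.2 using 1
    simp
  · rw [norm_mul, norm_mul, Complex.norm_exp_ofReal_mul_I, one_mul, RCLike.norm_conj]
    exact mul_le_mul_of_nonneg_left (hC _) (norm_nonneg _)
  · have h1 : ∀ t : ℝ, (p + t • ((1 : ℝ), (0 : ℝ))).1 = p.1 + t := fun t => by simp
    have h2 : ∀ t : ℝ, (p + t • ((1 : ℝ), (0 : ℝ))).2 = p.2 := fun t => by simp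
    simp only [h1, h2]
    refine HasDerivAt.const_mul _ (HasDerivAt.const_mul _ ?_)
    have h := HasDerivAt.scomp (h := fun t : ℝ => s + (p.1 + t)) t
      (hasDerivAt_schwartz φ (s + (p.1 + t))) (((hasDerivAt_id t).const_add p.1).const_add s)
    rw [one_smul] at h
    exact h

/-- The element `-(f + ∂f/∂a)` of the algebra. -/
def derFst (f : smoothAlgebra) : smoothAlgebra :=
  ⟨fun p => -(f.1 p + fderiv ℝ f.1 p (1, 0)), by
    have h1 := f.2.1
    refine ⟨(h1.add ((h1.fderiv_right (m := (⊤ : ℕ∞)) (by simp)).clm_apply contDiff_const)).neg, ?_⟩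
    exact (f.2.2.add (f.2.2.fderiv_apply (𝕜 := ℝ) (1, 0))).neg⟩

lemma denseRange_toL2 : DenseRange toL2 :=
  SchwartzMap.denseRange_toLpCLM (E := ℝ) (F := ℂ) (p := 2) (by simp)

lemma integrable_smoothAlgebra_mul (f : smoothAlgebra) {G : ℝ × ℝ → ℂ} (hG : Continuous G) :
    Integrable fun p : ℝ × ℝ => (Real.exp p.1 : ℂ) * f.1 p * G p := by
  have hf := f.2.1.continuous
  refine Continuous.integrable_of_hasCompactSupport (by fun_prop) (f.2.2.mono fun p hp hf0 => hp ?_)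
  simp [hf0]

lemma continuous_inner_groupRep (ν : SignType) (x y : L2) :
    Continuous fun p => ⟪x, groupRep ν p y⟫_ℂ :=
  continuous_const.inner (continuous_groupRep ν y)

/-- On the right, `d/ds` acts on `φ(s + a)` as `∂/∂a`, and the phase does not depend on `a`.
Integrating by parts in `a` moves it onto `eᵃ f`, and differentiating the weight `eᵃ` produces the
extra term `f` in `derFst`. -/
lemma rep_derS (ν : SignType) (f : smoothAlgebra) (φ : 𝓢(ℝ, ℂ)) :
    rep ν f (toL2 (derS φ)) = rep ν (derFst f) (toL2 φ) := by
  refine denseRange_toL2.eq_of_inner_right ℂ fun χ => ?_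
  have hF : ∀ p : ℝ × ℝ, HasLineDerivAt ℝ (fun p => (Real.exp p.1 : ℂ) * f.1 p)
      (-((Real.exp p.1 : ℂ) * (derFst f).1 p)) p (1, 0) := by
    intro p
    have h1 : HasFDerivAt f.1 (fderiv ℝ f.1 p) p :=
      (f.2.1.differentiable (by simp)).differentiableAt.hasFDerivAt
    have h2 : HasLineDerivAt ℝ (fun p : ℝ × ℝ => (Real.exp p.1 : ℂ)) (Real.exp p.1 : ℂ) p (1, 0) := by
      have h3 : HasDerivAt (fun t : ℝ => Real.exp (p.1 + t)) (Real.exp p.1) 0 := by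
        simpa using ((hasDerivAt_id (0 : ℝ)).const_add p.1).exp
      have h4 := h3.ofReal_comp
      rw [HasLineDerivAt]
      simpa using h4
    have h5 := HasDerivAt.mul h2 (h1.hasLineDerivAt (1, 0))
    refine HasDerivAt.congr_deriv h5 ?_
    simp only [zero_smul, add_zero, derFst]
    ring
  have h := integral_bilinear_hasLineDerivAt_right_eq_neg_left_of_integrable (μ := volume)
    (B := ContinuousLinearMap.mul ℝ ℂ) (f := fun p : ℝ × ℝ => (Real.exp p.1 : ℂ) * f.1 p)
    (f' := fun p => -((Real.exp p.1 : ℂ) * (derFst f).1 p)) (v := (1, 0))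
    (g := fun p => ⟪toL2 χ, groupRep ν p (toL2 φ)⟫_ℂ)
    (g' := fun p => ⟪toL2 χ, groupRep ν p (toL2 (derS φ))⟫_ℂ)
    ?_ (integrable_smoothAlgebra_mul f (continuous_inner_groupRep ν _ _))
    (integrable_smoothAlgebra_mul f (continuous_inner_groupRep ν _ _))
    (fun p _ => hF p) (fun p _ => hasLineDerivAt_inner_groupRep ν p χ φ)
  · simp only [ContinuousLinearMap.mul_apply', neg_mul, integral_neg, neg_neg] at h
    rw [inner_rep, inner_rep, h]
  · simp only [ContinuousLinearMap.mul_apply', neg_mul]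
    exact (integrable_smoothAlgebra_mul (derFst f) (continuous_inner_groupRep ν _ _)).neg

/-- Inversion in the affine group. -/
def invG : ℝ × ℝ ≃ₜ ℝ × ℝ where
  toFun p := (-p.1, -(Real.exp p.1 * p.2))
  invFun p := (-p.1, -(Real.exp p.1 * p.2))
  left_inv p := by
    ext <;> simp [← mul_assoc, ← Real.exp_add]
  right_inv p := by
    ext <;> simp [← mul_assoc, ← Real.exp_add]
  continuous_toFun := by fun_prop
  continuous_invFun := by fun_prop

lemma invG_apply (p : ℝ × ℝ) : invG p = (-p.1, -(Real.exp p.1 * p.2)) := rfl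

lemma invG_invG (p : ℝ × ℝ) : invG (invG p) = p := invG.left_inv p

/-- The substitution in `b` has Jacobian `e^(-a)`, which cancels the weight. Thus inversion
exchanges the left Haar measure `eᵃ da db` with the right Haar measure `da db`. -/
lemma integral_comp_invG {W : ℝ × ℝ → ℂ} (hW : Continuous W) (hc : HasCompactSupport W) :
    ∫ p : ℝ × ℝ, (Real.exp p.1 : ℂ) * W (invG p) = ∫ p, W p := by
  have h1 : Integrable W := hW.integrable_of_hasCompactSupport hc
  have h2 : Integrable fun p : ℝ × ℝ => (Real.exp p.1 : ℂ) * W (invG p) :=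
    Continuous.integrable_of_hasCompactSupport (by fun_prop) (hc.comp_homeomorph invG).mul_left
  rw [Measure.volume_eq_prod] at h1 h2 ⊢
  rw [integral_prod _ h1, integral_prod _ h2,
    ← integral_neg_eq_self (fun a : ℝ => ∫ b, W (a, b))]
  congr 1; ext a
  simp only [invG_apply]
  rw [integral_const_mul]
  have h3 := Measure.integral_comp_mul_left (fun b => W (-a, b)) (-Real.exp a)
  simp only [neg_mul] at h3
  rw [h3, abs_inv, abs_neg, abs_of_pos (Real.exp_pos a), Complex.real_smul, ← mul_assoc,
    ← Complex.ofReal_mul, mul_inv_cancel₀ (Real.exp_pos a).ne', Complex.ofReal_one, one_mul]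

lemma groupRep_invG (ν : SignType) (p : ℝ × ℝ) (x : L2) :
    groupRep ν p (groupRep ν (invG p) x) = x := by
  apply Lp.ext
  filter_upwards [groupRep_coeFn ν p (groupRep ν (invG p) x),
    (measurePreserving_add_right volume p.1).quasiMeasurePreserving.ae
      (groupRep_coeFn ν (invG p) x)] with s h1 h2
  rw [h1, h2, invG_apply, ← mul_assoc, ← Complex.exp_add, ← add_mul, ← Complex.ofReal_add]
  have : (ν : ℝ) * p.2 * Real.exp (-s) + (ν : ℝ) * -(Real.exp p.1 * p.2) * Real.exp (-(s + p.1))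
      = 0 := by
    rw [neg_add, Real.exp_add, Real.exp_neg p.1]
    field_simp
    ring
  rw [this, Complex.ofReal_zero, zero_mul, Complex.exp_zero, one_mul, add_neg_cancel_right]

lemma inner_groupRep_right (ν : SignType) (p : ℝ × ℝ) (x y : L2) :
    ⟪x, groupRep ν p y⟫_ℂ = ⟪groupRep ν (invG p) x, y⟫_ℂ := by
  conv_lhs => rw [← groupRep_invG ν p x]
  exact (groupRep ν p).inner_map_map _ _

/-- The involution of the algebra. -/
def starG (f : smoothAlgebra) : smoothAlgebra :=
  ⟨fun p => (Real.exp (-p.1) : ℂ) * starRingEnd ℂ (f.1 (invG p)), by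
    have h1 := f.2.1
    have h2 : ContDiff ℝ (⊤ : ℕ∞) fun p : ℝ × ℝ => (Real.exp (-p.1) : ℂ) :=
      Complex.ofRealCLM.contDiff.comp contDiff_fst.neg.exp
    have h3 : ContDiff ℝ (⊤ : ℕ∞) invG := by
      change ContDiff ℝ (⊤ : ℕ∞) fun p : ℝ × ℝ => (-p.1, -(Real.exp p.1 * p.2))
      fun_prop
    have h4 : ContDiff ℝ (⊤ : ℕ∞) fun p : ℝ × ℝ => starRingEnd ℂ (f.1 (invG p)) :=
      (Complex.conjCLE : ℂ →L[ℝ] ℂ).contDiff.comp (h1.comp h3)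
    refine ⟨h2.mul h4, HasCompactSupport.mul_left ?_⟩
    exact (f.2.2.comp_homeomorph invG).comp_left (map_zero _)⟩

lemma starG_apply (f : smoothAlgebra) (p : ℝ × ℝ) :
    (starG f).1 p = (Real.exp (-p.1) : ℂ) * starRingEnd ℂ (f.1 (invG p)) := rfl

/-- Unitarity of the group operators and the substitution `p ↦ p⁻¹`. The factor `e^(-a)` in `starG`
is the ratio of right to left Haar measure. -/
lemma inner_rep_right (ν : SignType) (f : smoothAlgebra) (x y : L2) :
    ⟪x, rep ν f y⟫_ℂ = ⟪rep ν (starG f) x, y⟫_ℂ := by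
  rw [← inner_conj_symm (rep ν (starG f) x), inner_rep, inner_rep, ← integral_conj]
  have hc := f.2.1.continuous
  have hi := continuous_inner_groupRep ν y x
  rw [← integral_comp_invG (W := fun p => starRingEnd ℂ ((Real.exp p.1 : ℂ) * (starG f).1 p *
    ⟪y, groupRep ν p x⟫_ℂ))]
  · congr 1; ext p
    rw [starG_apply, invG_invG, inner_groupRep_right]
    simp only [map_mul, inner_conj_symm, Complex.conj_conj, Complex.conj_ofReal]
    rw [← mul_assoc (Complex.ofReal _) (Complex.ofReal _), ← Complex.ofReal_mul, ← Real.exp_add,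
      add_neg_cancel, Real.exp_zero, Complex.ofReal_one, one_mul, mul_assoc]
  · have := (starG f).2.1.continuous
    fun_prop
  · exact (((starG f).2.2.mul_left).mul_right).comp_left (map_zero _)

lemma starG_starG (f : smoothAlgebra) : starG (starG f) = f := by
  apply Subtype.ext
  funext p
  rw [starG_apply, starG_apply, invG_invG, map_mul, Complex.conj_conj, Complex.conj_ofReal,
    ← mul_assoc, ← Complex.ofReal_mul, ← Real.exp_add, invG_apply]
  simp

lemma inner_rep_add (ν : SignType) (f g : smoothAlgebra) (x y : L2) :
    ⟪x, rep ν (f + g) y⟫_ℂ = ⟪x, rep ν f y⟫_ℂ + ⟪x, rep ν g y⟫_ℂ := by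
  rw [inner_rep, inner_rep, inner_rep, ← integral_add
    (integrable_smoothAlgebra_mul f (continuous_inner_groupRep ν _ _))
    (integrable_smoothAlgebra_mul g (continuous_inner_groupRep ν _ _))]
  congr 1; ext p
  change _ * (f.1 p + g.1 p) * _ = _
  ring

lemma inner_rep_smul (ν : SignType) (c : ℂ) (f : smoothAlgebra) (x y : L2) :
    ⟪x, rep ν (c • f) y⟫_ℂ = c * ⟪x, rep ν f y⟫_ℂ := by
  rw [inner_rep, inner_rep, ← integral_const_mul]
  congr 1; ext p
  change _ * (c * f.1 p) * _ = _
  ring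

/-- Taking adjoints puts the derivative on the right, where `rep_derS` applies. The derivative of
the phase `exp(iνb e^(-s))`, with its unbounded factor `e^(-s)`, never has to be handled. -/
lemma inner_derS_rep (ν : SignType) (f : smoothAlgebra) (χ φ : 𝓢(ℝ, ℂ)) :
    ⟪toL2 (derS χ), rep ν f (toL2 φ)⟫_ℂ =
      ⟪toL2 χ, rep ν (starG (derFst (starG f))) (toL2 φ)⟫_ℂ := by
  rw [inner_rep_right, rep_derS, inner_rep_right, starG_starG]

/-- The commutator of the oscillator with the representation, as a form on Schwartz functions. -/
lemma exists_inner_oscS_commutator (ν : SignType) (f : smoothAlgebra) :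
    ∃ g₁ g₂ : smoothAlgebra, ∀ χ φ : 𝓢(ℝ, ℂ),
      ⟪toL2 (oscS χ), rep ν f (toL2 φ)⟫_ℂ - ⟪toL2 χ, rep ν f (toL2 (oscS φ))⟫_ℂ =
        ⟪toL2 (raiseS χ), rep ν g₁ (toL2 φ)⟫_ℂ + ⟪toL2 χ, rep ν g₂ (toL2 φ)⟫_ℂ := by
  let D : smoothAlgebra → smoothAlgebra := fun g => starG (derFst (starG g))
  -- Commuting with `s²` gives `-2⟪sχ, π(af)φ⟫ - ⟪χ, π(a²f)φ⟫`. Writing `s = raiseS + d/ds` on `χ`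
  -- leaves `raiseS`, which sends a Hermite function to a multiple of a single one, and the
  -- derivative goes into `D (mulFst f)`. The last two terms come from `-d²/ds²`.
  refine ⟨(-2 : ℂ) • mulFst f, (-2 : ℂ) • D (mulFst f) + ((-1 : ℂ) • mulFst (mulFst f) +
    ((-1 : ℂ) • D (D f) + derFst (derFst f))), fun χ φ => ?_⟩
  simp only [inner_rep_add, inner_rep_smul, oscS_apply, raiseS_apply, map_sub, inner_sub_left,
    inner_sub_right, inner_rep_posS, rep_derS, inner_derS_rep, D]
  ring

end Algebra

/-! ### A virial estimate for oscillator eigenfunctions -/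

section Decay

lemma integrable_norm_sq_schwartz (φ : 𝓢(ℝ, ℂ)) : Integrable fun s => ‖φ s‖ ^ 2 :=
  (memLp_two_iff_integrable_sq_norm φ.continuous.aestronglyMeasurable).1 (φ.memLp 2)

lemma norm_toL2_sq (φ : 𝓢(ℝ, ℂ)) : ‖toL2 φ‖ ^ 2 = ∫ s, ‖φ s‖ ^ 2 := by
  have h := inner_self_eq_ofReal (toL2 φ)
  rw [L2.inner_def] at h
  have h2 : ∫ s, ⟪toL2 φ s, toL2 φ s⟫_ℂ = ∫ s, ((‖φ s‖ ^ 2 : ℝ) : ℂ) := by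
    refine integral_congr_ae ?_
    filter_upwards [coeFn_toL2 φ] with s hs
    rw [hs, inner_self_eq_ofReal]
  rw [h2, integral_complex_ofReal] at h
  exact (Complex.ofReal_injective h).symm

/-- Energy identity for a rescaled oscillator eigenfunction. -/
lemma norm_posS_sq_le {v : 𝓢(ℝ, ℂ)} {β Λ : ℝ}
    (hv : derS (derS v) = ((β ^ 2 : ℝ) : ℂ) • posS (posS v) - (Λ : ℂ) • v) :
    β ^ 2 * ‖toL2 (posS v)‖ ^ 2 ≤ Λ * ‖toL2 v‖ ^ 2 := by
  have h1 := inner_derS v (derS v)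
  have h2 : ⟪toL2 (posS v), toL2 (posS v)⟫_ℂ = ⟪toL2 v, toL2 (posS (posS v))⟫_ℂ := inner_posS v _
  rw [hv, map_sub, map_smul, map_smul, inner_sub_right, inner_smul_right, inner_smul_right, ← h2,
    inner_self_eq_ofReal, inner_self_eq_ofReal, inner_self_eq_ofReal] at h1
  -- Pairing the equation with `v` expresses the kinetic energy, which is nonnegative.
  have h3 : ‖toL2 (derS v)‖ ^ 2 = -(β ^ 2 * ‖toL2 (posS v)‖ ^ 2 - Λ * ‖toL2 v‖ ^ 2) := by
    exact_mod_cast h1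
  nlinarith [sq_nonneg ‖toL2 (derS v)‖]

/-- Virial estimate: eigenfunctions of a rescaled oscillator have little mass near the origin. -/
lemma integral_norm_sq_div_le {v : 𝓢(ℝ, ℂ)} {β L : ℝ} (hβ : 0 < β) (hL : 0 < L)
    (hv : derS (derS v) = ((β ^ 2 : ℝ) : ℂ) • posS (posS v) - (((β * L) ^ 2 : ℝ) : ℂ) • v) :
    L ^ 2 * ∫ s, (1 + s ^ 2)⁻¹ * ‖v s‖ ^ 2 ≤ (1 + Real.pi * L) * ‖toL2 v‖ ^ 2 := by
  set A : ℝ → ℝ := fun s => ‖derS v s‖ ^ 2 with hA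
  set B : ℝ → ℝ := fun s => ‖v s‖ ^ 2 with hB
  -- Classical energy of the equation `v'' = β²(s² - L²)v`. In `E'` every term cancels except the
  -- one that differentiates the potential.
  set E : ℝ → ℝ := fun s => A s + β ^ 2 * (L ^ 2 - s ^ 2) * B s with hE
  have hP : ∀ s, ‖posS v s‖ ^ 2 = s ^ 2 * B s := fun s => by
    rw [posS_apply, norm_mul, mul_pow, Complex.norm_real, Real.norm_eq_abs, sq_abs]
  have hAi : Integrable A := integrable_norm_sq_schwartz _
  have hBi : Integrable B := integrable_norm_sq_schwartz _
  have hCi : Integrable fun s => s ^ 2 * B s := by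
    simpa only [hP] using integrable_norm_sq_schwartz (posS v)
  have hA0 : ∀ s, 0 ≤ A s := fun s => by positivity
  have hB0 : ∀ s, 0 ≤ B s := fun s => by positivity
  have hBc : Continuous B := by have := v.continuous; fun_prop
  have hEd : ∀ s, HasDerivAt E (-(2 * β ^ 2 * s * B s)) s := by
    intro s
    have h1 : HasDerivAt A (2 * inner ℝ (derS v s) (derS (derS v) s)) s :=
      (hasDerivAt_schwartz (derS v) s).norm_sq
    have h2 : HasDerivAt B (2 * inner ℝ (v s) (derS v s)) s := (hasDerivAt_schwartz v s).norm_sq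
    have h3 : HasDerivAt (fun s : ℝ => β ^ 2 * (L ^ 2 - s ^ 2)) (β ^ 2 * (-(2 * s))) s := by
      have := (((hasDerivAt_id s).pow 2).const_sub (L ^ 2)).const_mul (β ^ 2)
      simpa using this
    refine (h1.add (h3.mul h2)).congr_deriv ?_
    have h4 : derS (derS v) s = (β ^ 2 * (s ^ 2 - L ^ 2)) • v s := by
      rw [hv, sub_apply, smul_apply, smul_apply, posS_apply, posS_apply, smul_eq_mul, smul_eq_mul,
        Complex.real_smul]
      push_cast
      ring
    rw [h4, inner_smul_right, real_inner_comm]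
    simp only [hB]
    ring
  -- Virial multiplier: `arctan` is bounded and its derivative is the weight `(1 + s²)⁻¹`. The total
  -- derivative integrates to zero, so `∫ (1 + s²)⁻¹ E = 2β² ∫ s arctan(s) |v|²`.
  have hF : ∀ s, HasDerivAt (fun s => Real.arctan s * E s)
      ((1 + s ^ 2)⁻¹ * E s - 2 * β ^ 2 * (s * Real.arctan s * B s)) s := by
    intro s
    refine ((Real.hasDerivAt_arctan' s).mul (hEd s)).congr_deriv ?_
    ring
  have hatan : ∀ s, |Real.arctan s| ≤ Real.pi / 2 := fun s =>
    abs_le.2 ⟨(Real.neg_pi_div_two_lt_arctan s).le, (Real.arctan_lt_pi_div_two s).le⟩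
  have hinv : ∀ s : ℝ, (1 + s ^ 2)⁻¹ ≤ 1 := fun s => inv_le_one_of_one_le₀ (by nlinarith)
  have hEi : Integrable E := by
    have := hAi.add (((hBi.const_mul (L ^ 2)).sub hCi).const_mul (β ^ 2))
    refine this.congr (.of_forall fun s => ?_)
    simp only [Pi.add_apply, Pi.sub_apply, hE]
    ring
  have hFi : Integrable fun s => Real.arctan s * E s :=
    hEi.bdd_mul Real.continuous_arctan.aestronglyMeasurable (.of_forall hatan)
  have hgi : Integrable fun s => (1 + s ^ 2)⁻¹ * E s := by
    refine hEi.bdd_mul (c := 1) (by fun_prop : Measurable _).aestronglyMeasurable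
      (.of_forall fun s => ?_)
    rw [Real.norm_of_nonneg (by positivity)]
    exact hinv s
  -- Arithmetic–geometric mean at the scale `L`, the turning point. Both resulting terms integrate
  -- to at most `L‖v‖²`.
  have hsB : ∀ s, |s| * B s ≤ (s ^ 2 * B s / L + L * B s) / 2 := by
    intro s
    have h1 : |s| ≤ (s ^ 2 / L + L) / 2 := by
      rw [le_div_iff₀ two_pos, ← sub_nonneg]
      have : s ^ 2 / L + L - |s| * 2 = (|s| - L) ^ 2 / L := by
        rw [← sq_abs s]; field_simp; ring
      rw [this]
      positivity
    calc |s| * B s ≤ (s ^ 2 / L + L) / 2 * B s := mul_le_mul_of_nonneg_right h1 (hB0 s)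
      _ = _ := by ring
  have hsBi : Integrable fun s => (s ^ 2 * B s / L + L * B s) / 2 :=
    ((hCi.div_const L).add (hBi.const_mul L)).div_const 2
  have hsa : ∀ s, |s * Real.arctan s * B s| ≤ Real.pi / 2 * ((s ^ 2 * B s / L + L * B s) / 2) := by
    intro s
    rw [abs_mul, abs_mul, abs_of_nonneg (hB0 s), mul_comm |s|, mul_assoc]
    exact mul_le_mul (hatan s) (hsB s) (by have := hB0 s; positivity) (by positivity)
  have hki : Integrable fun s => s * Real.arctan s * B s :=
    (hsBi.const_mul _).mono' (by
      have := Real.continuous_arctan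
      exact (by fun_prop : Continuous fun s => s * Real.arctan s * B s).aestronglyMeasurable)
      (.of_forall hsa)
  have hzero := integral_eq_zero_of_hasDerivAt_of_integrable hF (hgi.sub (hki.const_mul _)) hFi
  have hwi : Integrable fun s => (1 + s ^ 2)⁻¹ * B s := by
    refine hBi.bdd_mul (c := 1) (by fun_prop : Measurable _).aestronglyMeasurable
      (.of_forall fun s => ?_)
    rw [Real.norm_of_nonneg (by positivity)]
    exact hinv s
  -- In `E` the term `|v'|²` is dropped and `s²/(1 + s²) ≤ 1` is used. The right side of this
  -- inequality is zero by `hzero`.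
  have hle : ∫ s, (β ^ 2 * L ^ 2 * ((1 + s ^ 2)⁻¹ * B s) - β ^ 2 * (B s +
      Real.pi * ((s ^ 2 * B s / L + L * B s) / 2))) ≤
      ∫ s, ((1 + s ^ 2)⁻¹ * E s - 2 * β ^ 2 * (s * Real.arctan s * B s)) := by
    refine integral_mono ((hwi.const_mul _).sub ((hBi.add (hsBi.const_mul _)).const_mul _))
      (hgi.sub (hki.const_mul _)) fun s => ?_
    simp only [hE]
    have h1 := (abs_le.1 (hsa s)).2
    have h2 : (1 + s ^ 2)⁻¹ * (s ^ 2 * B s) ≤ B s := by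
      rw [← mul_assoc]
      refine mul_le_of_le_one_left (hB0 s) ?_
      rw [inv_mul_le_one₀ (by positivity)]
      linarith
    have h3 : 0 ≤ (1 + s ^ 2)⁻¹ * A s := mul_nonneg (by positivity) (hA0 s)
    have h4 : 0 ≤ β ^ 2 := by positivity
    nlinarith [mul_le_mul_of_nonneg_left h1 h4, mul_le_mul_of_nonneg_left h2 h4]
  have hBs : Integrable fun s => B s + Real.pi * ((s ^ 2 * B s / L + L * B s) / 2) :=
    hBi.add (hsBi.const_mul _)
  rw [hzero, integral_sub (hwi.const_mul _) (hBs.const_mul _),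
    integral_const_mul, integral_const_mul, integral_add hBi (hsBi.const_mul _),
    integral_const_mul, integral_div, integral_add (hCi.div_const L) (hBi.const_mul L),
    integral_div, integral_const_mul] at hle
  have hN : ∫ s, B s = ‖toL2 v‖ ^ 2 := (norm_toL2_sq v).symm
  have hQ : ∫ s, s ^ 2 * B s = ‖toL2 (posS v)‖ ^ 2 := by simp_rw [norm_toL2_sq, hP]
  rw [hN, hQ] at hle
  have hQle : ‖toL2 (posS v)‖ ^ 2 ≤ L ^ 2 * ‖toL2 v‖ ^ 2 := by
    have := norm_posS_sq_le hv
    rw [mul_pow, mul_assoc] at this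
    exact le_of_mul_le_mul_left this (by positivity)
  have hQle' : ‖toL2 (posS v)‖ ^ 2 / L ≤ L * ‖toL2 v‖ ^ 2 := by
    rw [div_le_iff₀ hL]
    linarith
  have h5 : β ^ 2 * (L ^ 2 * ∫ s, (1 + s ^ 2)⁻¹ * B s) ≤ β ^ 2 * (‖toL2 v‖ ^ 2 +
      Real.pi * ((‖toL2 (posS v)‖ ^ 2 / L + L * ‖toL2 v‖ ^ 2) / 2)) := by linarith
  have h6 := le_of_mul_le_mul_left h5 (by positivity)
  nlinarith [mul_le_mul_of_nonneg_left hQle' Real.pi_pos.le]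

/-! ### Fourier transform and decay of `π_ν(f)` on Hermite functions -/

open FourierTransform

/-- The Fourier transform on Schwartz functions. -/
def fouS : 𝓢(ℝ, ℂ) →ₗ[ℂ] 𝓢(ℝ, ℂ) := (fourierCLM ℂ 𝓢(ℝ, ℂ)).toLinearMap

lemma fouS_def (φ : 𝓢(ℝ, ℂ)) : fouS φ = 𝓕 φ := rfl

lemma fouS_injective : Function.Injective fouS := fun φ ψ h => by
  have := congrArg (fun χ : 𝓢(ℝ, ℂ) => 𝓕⁻ χ) h
  simpa [fouS_def] using this

lemma norm_toL2_fouS (φ : 𝓢(ℝ, ℂ)) : ‖toL2 (fouS φ)‖ = ‖toL2 φ‖ :=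
  SchwartzMap.norm_fourier_toL2_eq φ

lemma fouS_derS (φ : 𝓢(ℝ, ℂ)) : fouS (derS φ) = (2 * Real.pi * Complex.I) • posS (fouS φ) := by
  ext s
  have h := congrFun (Real.fourier_deriv φ.integrable φ.differentiable (derS φ).integrable) s
  rw [smul_apply, posS_apply]
  refine h.trans ?_
  rw [smul_eq_mul, smul_eq_mul]
  change _ * fouS φ s = _
  ring

lemma derS_fouS (φ : 𝓢(ℝ, ℂ)) : derS (fouS φ) = -(2 * Real.pi * Complex.I) • fouS (posS φ) := by
  rw [← map_smul]
  ext s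
  have hi : Integrable fun s : ℝ => s • φ s := by
    refine (posS φ).integrable.congr (.of_forall fun s => ?_)
    simp only [posS_apply, Complex.real_smul]
  have h := congrFun (Real.deriv_fourier φ.integrable hi) s
  refine h.trans ?_
  refine congrArg (fun g : ℝ → ℂ => 𝓕 g s) (funext fun t => ?_)
  rw [smul_apply, posS_apply, smul_eq_mul, smul_eq_mul]
  ring

/-- The Fourier transform exchanges `s` and `d/ds` up to factors `2πi`. The result is in the form
required by `integral_norm_sq_div_le`, with `β = 4π²` and turning point `L = √r / (2π)`. -/
lemma derS_derS_fouS {φ : 𝓢(ℝ, ℂ)} {r : ℝ} (hr : 0 ≤ r) (h : oscS φ = (r : ℂ) • φ) :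
    derS (derS (fouS φ)) = (((4 * Real.pi ^ 2) ^ 2 : ℝ) : ℂ) • posS (posS (fouS φ)) -
      (((4 * Real.pi ^ 2 * (√r / (2 * Real.pi))) ^ 2 : ℝ) : ℂ) • fouS φ := by
  have h1 := congrArg fouS h
  rw [oscS_apply, map_sub, map_smul, fouS_derS, fouS_derS, map_smul] at h1
  have h2 : derS (derS (fouS φ)) = -(2 * Real.pi * Complex.I) • -(2 * Real.pi * Complex.I) •
      fouS (posS (posS φ)) := by
    rw [derS_fouS, map_smul, derS_fouS]
  have h4 : (2 * Real.pi * Complex.I : ℂ) * (2 * Real.pi * Complex.I) = -(4 * Real.pi ^ 2) := by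
    linear_combination (4 * Real.pi ^ 2 : ℂ) * Complex.I_mul_I
  rw [smul_smul, h4] at h1
  rw [h2, smul_smul, neg_mul_neg, h4, eq_add_of_sub_eq h1]
  have h3 : (((4 * Real.pi ^ 2 * (√r / (2 * Real.pi))) ^ 2 : ℝ) : ℂ) = 4 * Real.pi ^ 2 * r := by
    rw [show (4 * Real.pi ^ 2 * (√r / (2 * Real.pi))) ^ 2 = 4 * Real.pi ^ 2 * √r ^ 2 by
      field_simp; ring, Real.sq_sqrt hr]
    push_cast
    ring
  rw [h3]
  module

/-- Since `π_ν(f)` absorbs derivatives on its right, `K = π_ν(f)(1 - (4π²)⁻¹ d²/ds²)` extends to a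
bounded operator. Dividing `fouS φ` by `1 + s²` inverts the differential factor. -/
lemma exists_norm_rep_le (ν : SignType) (f : smoothAlgebra) : ∃ C : ℝ, 0 ≤ C ∧ ∀ φ : 𝓢(ℝ, ℂ),
    ‖rep ν f (toL2 φ)‖ ^ 2 ≤ C * ∫ s, (1 + s ^ 2)⁻¹ * ‖fouS φ s‖ ^ 2 := by
  set c : ℂ := (2 * Real.pi * Complex.I) ^ 2 with hc
  have hc0 : c ≠ 0 := by simp [hc, Real.pi_ne_zero]
  set K : L2 →L[ℂ] L2 := rep ν f + c⁻¹ • rep ν (derFst (derFst f)) with hK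
  refine ⟨‖K‖ ^ 2, by positivity, fun φ => ?_⟩
  have hg : (fun s : ℝ => (((1 + ‖s‖ ^ 2) ^ (-1 : ℝ) : ℝ))).HasTemperateGrowth :=
    Function.hasTemperateGrowth_one_add_norm_sq_rpow ℝ (-1)
  set w : 𝓢(ℝ, ℂ) := SchwartzMap.smulLeftCLM ℂ (fun s : ℝ => ((1 + ‖s‖ ^ 2) ^ (-1 : ℝ) : ℝ))
    (fouS φ) with hw
  have hws : ∀ s, w s = ((1 + s ^ 2)⁻¹ : ℝ) * fouS φ s := by
    intro s
    rw [hw, SchwartzMap.smulLeftCLM_apply_apply hg, Complex.real_smul, Real.rpow_neg_one,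
      Real.norm_eq_abs, sq_abs]
  set ψ : 𝓢(ℝ, ℂ) := 𝓕⁻ w with hψ
  have hψw : fouS ψ = w := by rw [fouS_def, hψ, fourier_fourierInv_eq]
  have hφ : φ = ψ + c⁻¹ • derS (derS ψ) := by
    apply fouS_injective
    rw [map_add, map_smul, fouS_derS, fouS_derS, map_smul, 
      smul_smul (2 * Real.pi * Complex.I : ℂ), ← sq, smul_smul,
      ← hc, inv_mul_cancel₀ hc0, one_smul, hψw]
    ext s
    have hs : (1 + (s : ℂ) ^ 2) ≠ 0 := by
      have : (1 + s ^ 2 : ℝ) ≠ 0 := by positivity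
      exact_mod_cast this
    rw [add_apply, posS_apply, posS_apply, hws]
    push_cast
    field_simp
  have h1 : rep ν f (toL2 φ) = K (toL2 ψ) := by
    conv_lhs => rw [hφ]
    rw [map_add, map_add, map_smul, map_smul, rep_derS, rep_derS]
    rfl
  have h2 : ‖rep ν f (toL2 φ)‖ ≤ ‖K‖ * ‖toL2 ψ‖ := h1 ▸ K.le_opNorm _
  calc ‖rep ν f (toL2 φ)‖ ^ 2 ≤ (‖K‖ * ‖toL2 ψ‖) ^ 2 := by gcongr
    _ = ‖K‖ ^ 2 * ∫ s, ‖w s‖ ^ 2 := by rw [mul_pow, ← norm_toL2_fouS, hψw, norm_toL2_sq]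
    _ ≤ _ := by
      refine mul_le_mul_of_nonneg_left (integral_mono_of_nonneg (.of_forall fun s => by positivity)
        ?_ (.of_forall fun s => ?_)) (by positivity)
      · refine (integrable_norm_sq_schwartz (fouS φ)).bdd_mul (c := 1)
          (by fun_prop : Measurable _).aestronglyMeasurable (.of_forall fun s => ?_)
        rw [Real.norm_of_nonneg (by positivity)]
        exact inv_le_one_of_one_le₀ (by nlinarith)
      -- The square of the weight is available, but the first power suffices and is the one in the
      -- virial estimate.
      · simp only [hws, norm_mul, Complex.norm_real, mul_pow]
        refine mul_le_mul_of_nonneg_right ?_ (by positivity)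
        rw [Real.norm_of_nonneg (by positivity)]
        exact pow_le_of_le_one (by positivity) (inv_le_one_of_one_le₀ (by nlinarith)) two_ne_zero

/-- The virial bound with `L` proportional to `√(2n + 1)` makes the weighted mass of `fouS hₙ` of
order `(2n + 1)^(-1/2)`. The norm is controlled by its square root. -/
lemma exists_norm_rep_hermiteS_le (ν : SignType) (f : smoothAlgebra) : ∃ C : ℝ, 0 ≤ C ∧ ∀ n : ℕ,
    ‖rep ν f (toL2 (hermiteS n))‖ ≤ C * (2 * n + 1 : ℝ) ^ (-(1 / 4) : ℝ) := by
  obtain ⟨C, hC0, hC⟩ := exists_norm_rep_le ν f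
  set D : ℝ := C * (4 * Real.pi ^ 2 + 2 * Real.pi ^ 2) with hD
  have hD0 : 0 ≤ D := by positivity
  refine ⟨√D, Real.sqrt_nonneg _, fun n => ?_⟩
  set r : ℝ := 2 * n + 1 with hr
  have hr1 : 1 ≤ r := by rw [hr]; linarith [(Nat.cast_nonneg n : (0 : ℝ) ≤ n)]
  have hr0 : 0 < r := one_pos.trans_le hr1
  have h1 := integral_norm_sq_div_le (by positivity) (by positivity)
    (derS_derS_fouS hr0.le (oscS_hermiteS n))
  rw [norm_toL2_fouS, norm_hermiteS] at h1
  set J := ∫ s, (1 + s ^ 2)⁻¹ * ‖fouS (hermiteS n) s‖ ^ 2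
  set q := √r with hq
  have hq1 : 1 ≤ q := Real.one_le_sqrt.2 hr1
  have h2 : J ≤ (4 * Real.pi ^ 2 + 2 * Real.pi ^ 2) / q := by
    rw [le_div_iff₀ (by positivity)]
    have h3 : q ^ 2 * J ≤ 4 * Real.pi ^ 2 + 2 * Real.pi ^ 2 * q := by
      have h4 : q ^ 2 * J = 4 * Real.pi ^ 2 * ((q / (2 * Real.pi)) ^ 2 * J) := by
        field_simp; ring
      have h5 : 4 * Real.pi ^ 2 + 2 * Real.pi ^ 2 * q =
          4 * Real.pi ^ 2 * ((1 + Real.pi * (q / (2 * Real.pi))) * 1 ^ 2) := by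
        field_simp; ring
      rw [h4, h5]
      gcongr
    have h6 : q * (J * q) ≤ q * (4 * Real.pi ^ 2 + 2 * Real.pi ^ 2) := by
      nlinarith [sq_nonneg Real.pi]
    exact le_of_mul_le_mul_left h6 (by positivity)
  have h3 : ‖rep ν f (toL2 (hermiteS n))‖ ^ 2 ≤ D * (1 / q) := by
    refine (hC (hermiteS n)).trans ((mul_le_mul_of_nonneg_left h2 hC0).trans_eq ?_)
    rw [hD]; ring
  refine (sq_le_sq₀ (norm_nonneg _) (by positivity)).1 (h3.trans_eq ?_)
  rw [mul_pow, Real.sq_sqrt hD0, ← Real.rpow_natCast, ← Real.rpow_mul hr0.le, hq, Real.sqrt_eq_rpow,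
    one_div, ← Real.rpow_neg hr0.le]
  norm_num

end Decay

/-! ### Diagonalization of `𝒟` and decay of the commutator -/

section Commutator

lemma diracS_single_zero_eq (ν : SignType) (φ : 𝓢(ℝ, ℂ)) :
    diracS (Pi.single (ν, 0) φ) = Pi.single (ν, 1) (lowerS φ) := by
  rw [diracS_single_zero, momS_eq, smul_smul, lowerS_apply]
  simp

lemma diracS_single_one_eq (ν : SignType) (φ : 𝓢(ℝ, ℂ)) :
    diracS (Pi.single (ν, 1) φ) = Pi.single (ν, 0) (raiseS φ) := by
  rw [diracS_single_one, momS_eq, smul_smul, raiseS_apply]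
  simp

/-- The vectors of the Hermite basis of `H`. -/
def hermiteH (k : (SignType × Fin 2) × ℕ) : H := embS (Pi.single k.1 (hermiteS k.2))

/-- The component `j = 0` carries `raiseS ∘ lowerS`, with eigenvalue `2n`, and `j = 1` carries
`lowerS ∘ raiseS`, with eigenvalue `2n + 2`. -/
lemma diracS_diracS_single (k : (SignType × Fin 2) × ℕ) :
    diracS (diracS (Pi.single k.1 (hermiteS k.2))) =
      ((2 * k.2 + 2 * (k.1.2 : ℕ) : ℝ) : ℂ) • Pi.single k.1 (hermiteS k.2) := by
  obtain ⟨⟨ν, j⟩, n⟩ := k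
  have h : ∀ (i : SignType × Fin 2) (c d : ℝ), d = 2 * n + 1 + c → Pi.single (M := fun _ => 𝓢(ℝ, ℂ)) i
      (oscS (hermiteS n) + (c : ℂ) • hermiteS n) = (d : ℂ) • Pi.single i (hermiteS n) := by
    rintro i c d rfl
    rw [oscS_hermiteS, ← add_smul, ← Complex.ofReal_add, Pi.single_smul]
  fin_cases j
  · simp only [Fin.zero_eta, diracS_single_zero_eq, diracS_single_one_eq, raiseS_lowerS]
    rw [← h (ν, 0) (-1) _ (by norm_num)]
    simp [sub_eq_add_neg]
  · simp only [Fin.mk_one, diracS_single_zero_eq, diracS_single_one_eq, lowerS_raiseS]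
    rw [← h (ν, 1) 1 _ (by norm_num; ring)]
    simp

lemma embS_mem_dirac (φ : SignType × Fin 2 → 𝓢(ℝ, ℂ)) : embS φ ∈ dirac.domain :=
  diracCore.le_closure.1 (LinearMap.mem_range_self embS φ)

lemma dirac_embS (φ : SignType × Fin 2 → 𝓢(ℝ, ℂ)) (h : embS φ ∈ dirac.domain) :
    dirac ⟨embS φ, h⟩ = embS (diracS φ) := by
  rw [← diracCore_apply]
  exact (diracCore.le_closure.2 rfl).symm

/-- The eigenvalue of `(1 + 𝒟²)^(-1/2)` on a vector of the Hermite basis. -/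
def diracEig (k : (SignType × Fin 2) × ℕ) : ℝ := (√(2 * k.2 + 1 + 2 * (k.1.2 : ℕ)))⁻¹

lemma invSqrtOneAddSq_hermiteH (k : (SignType × Fin 2) × ℕ) :
    invSqrtOneAddSq dirac (hermiteH k) = (diracEig k : ℂ) • hermiteH k := by
  refine sqrt_apply_eigenvector (invOneAddSq_nonneg _) (by unfold diracEig; positivity) ?_
  set φ : SignType × Fin 2 → 𝓢(ℝ, ℂ) := Pi.single k.1 (hermiteS k.2) with hφ
  have h1 : dirac ⟨embS φ, embS_mem_dirac φ⟩ ∈ dirac.domain := by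
    rw [dirac_embS]; exact embS_mem_dirac _
  have h2 : dirac ⟨dirac ⟨embS φ, embS_mem_dirac φ⟩, h1⟩ =
      ((2 * k.2 + 2 * (k.1.2 : ℕ) : ℝ) : ℂ) • embS φ := by
    have h5 : diracS (diracS φ) = ((2 * k.2 + 2 * (k.1.2 : ℕ) : ℝ) : ℂ) • φ :=
      diracS_diracS_single k
    rw [← map_smul, ← h5, ← dirac_embS _ (embS_mem_dirac _)]
    congr 2
    exact dirac_embS _ _
  have h3 := invOneAddSq_add_sq isSelfAdjoint_dirac ⟨embS φ, embS_mem_dirac φ⟩ h1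
  rw [h2] at h3
  set r : ℝ := 2 * k.2 + 1 + 2 * (k.1.2 : ℕ) with hr
  have hr0 : 0 < r := by positivity
  have h4 : embS φ + ((2 * k.2 + 2 * (k.1.2 : ℕ) : ℝ) : ℂ) • embS φ = (r : ℂ) • embS φ := by
    nth_rw 1 [← one_smul ℂ (embS φ)]
    rw [← add_smul, hr]
    congr 1
    push_cast
    ring
  simp only [h4, map_smul] at h3
  change invOneAddSq dirac (embS φ) = _ • embS φ
  rw [diracEig, inv_pow, Real.sq_sqrt hr0.le]
  nth_rw 2 [← h3]
  rw [smul_smul, ← Complex.ofReal_mul, inv_mul_cancel₀ hr0.ne', Complex.ofReal_one, one_smul]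

lemma embS_single_same (i : SignType × Fin 2) (φ : 𝓢(ℝ, ℂ)) : embS (Pi.single i φ) i = toL2 φ := by
  rw [embS_apply, Pi.single_eq_same, toL2_def]

lemma embS_single_ne {i k : SignType × Fin 2} (h : k ≠ i) (φ : 𝓢(ℝ, ℂ)) :
    embS (Pi.single i φ) k = 0 := by
  rw [embS_apply, Pi.single_eq_of_ne h]
  exact map_zero toL2

lemma inner_embS_single_left (u : H) (i : SignType × Fin 2) (φ : 𝓢(ℝ, ℂ)) :
    ⟪embS (Pi.single i φ), u⟫_ℂ = ⟪toL2 φ, u i⟫_ℂ := by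
  rw [← inner_conj_symm, inner_embS_single, inner_conj_symm, toL2_def]

lemma orthonormal_hermiteH : Orthonormal ℂ hermiteH := by
  rw [orthonormal_iff_ite]
  rintro ⟨i, n⟩ ⟨k, m⟩
  rw [hermiteH, inner_embS_single_left, hermiteH]
  by_cases h : i = k
  · subst h
    simp only
    rw [embS_single_same, orthonormal_iff_ite.1 orthonormal_hermiteS n m]
    simp
  · simp only
    rw [embS_single_ne h, inner_zero_right, if_neg (by simp [h])]

/-- The Hermite basis of `H`. -/
def hermiteBasis : HilbertBasis ((SignType × Fin 2) × ℕ) ℂ H :=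
  HilbertBasis.mkOfOrthogonalEqBot orthonormal_hermiteH (by
    rw [Submodule.eq_bot_iff]
    intro u hu
    rw [Submodule.mem_orthogonal] at hu
    ext1 i
    refine eq_zero_of_inner_hermiteS fun n => ?_
    have h := hu (hermiteH (i, n)) (Submodule.subset_span ⟨_, rfl⟩)
    rw [hermiteH, inner_embS_single_left] at h
    rw [← inner_conj_symm, h, map_zero])

lemma hermiteBasis_apply (k : (SignType × Fin 2) × ℕ) : hermiteBasis k = hermiteH k := by
  rw [hermiteBasis, HilbertBasis.coe_mkOfOrthogonalEqBot]

lemma inner_repH_of_ne {i k : SignType × Fin 2} (h : k ≠ i) (f : smoothAlgebra)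
    (χ φ : 𝓢(ℝ, ℂ)) : ⟪embS (Pi.single k χ), repH f (embS (Pi.single i φ))⟫_ℂ = 0 := by
  rw [inner_embS_single_left, repH_apply, embS_single_ne h, map_zero, inner_zero_right]

lemma inner_repH_same (i : SignType × Fin 2) (f : smoothAlgebra) (χ φ : 𝓢(ℝ, ℂ)) :
    ⟪embS (Pi.single i χ), repH f (embS (Pi.single i φ))⟫_ℂ = ⟪toL2 χ, rep i.1 f (toL2 φ)⟫_ℂ := by
  rw [inner_embS_single_left, repH_apply, embS_single_same]

lemma norm_repH_embS_single (i : SignType × Fin 2) (f : smoothAlgebra) (φ : 𝓢(ℝ, ℂ)) :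
    ‖repH f (embS (Pi.single i φ))‖ = ‖rep i.1 f (toL2 φ)‖ := by
  have h : ‖repH f (embS (Pi.single i φ))‖ ^ 2 = ‖rep i.1 f (toL2 φ)‖ ^ 2 := by
    rw [PiLp.norm_sq_eq_of_L2, Finset.sum_eq_single i]
    · rw [repH_apply, embS_single_same]
    · intro k _ hk
      rw [repH_apply, embS_single_ne hk, map_zero, norm_zero, zero_pow two_ne_zero]
    · simp
  exact (sq_eq_sq₀ (norm_nonneg _) (norm_nonneg _)).1 h

/-- With `a, b` the two roots, the difference is `(y - x)/(ab(a + b))`, where `a ≥ √x` and `b(a + b)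
≥ b² ≥ y`. The bound is deliberately asymmetric: the full power goes to the fixed index `n`, and
only `x^(-1/2)` to the summed index `m`. The shift `c = 2j` is that of the spinor component. -/
lemma abs_inv_sqrt_sub_inv_sqrt_le {x y c : ℝ} (hx : 0 < x) (hy : 0 < y) (hc : 0 ≤ c) :
    |(√(x + c))⁻¹ - (√(y + c))⁻¹| ≤ y⁻¹ * (√x)⁻¹ * |x - y| := by
  set a := √(x + c) with ha
  set b := √(y + c) with hb
  have ha0 : 0 < a := Real.sqrt_pos.2 (by positivity)
  have hb0 : 0 < b := Real.sqrt_pos.2 (by positivity)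
  have ha2 : a ^ 2 = x + c := Real.sq_sqrt (by positivity)
  have hb2 : b ^ 2 = y + c := Real.sq_sqrt (by positivity)
  have hax : √x ≤ a := Real.sqrt_le_sqrt (by linarith)
  have hx0 : 0 < √x := Real.sqrt_pos.2 hx
  have h1 : a⁻¹ - b⁻¹ = (a * (b * (a + b)))⁻¹ * (y - x) := by
    have : y - x = (b - a) * (a + b) := by linear_combination ha2 - hb2
    rw [this]
    field_simp
  rw [h1, abs_mul, abs_sub_comm y x, abs_of_pos (by positivity), ← mul_inv, mul_comm y]
  refine mul_le_mul_of_nonneg_right (inv_anti₀ (by positivity) ?_) (abs_nonneg _)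
  refine mul_le_mul hax ?_ hy.le ha0.le
  nlinarith

/-- Decay of the commutator on the Hermite basis. -/
lemma exists_norm_commutator_hermiteH_le (f : smoothAlgebra) (i : SignType × Fin 2) :
    ∃ C : ℝ, 0 ≤ C ∧ ∀ n : ℕ,
      ‖(invSqrtOneAddSq dirac ∘L repH f - repH f ∘L invSqrtOneAddSq dirac) (hermiteH (i, n))‖ ≤
        C * (2 * n + 1 : ℝ) ^ (-(5 / 4) : ℝ) := by
  obtain ⟨g₁, g₂, hg⟩ := exists_inner_oscS_commutator i.1 f
  obtain ⟨C₁, hC₁, h₁⟩ := exists_norm_rep_hermiteS_le i.1 g₁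
  obtain ⟨C₂, hC₂, h₂⟩ := exists_norm_rep_hermiteS_le i.1 g₂
  refine ⟨3 * C₁ + 2 * C₂, by positivity, fun n => ?_⟩
  set S := invSqrtOneAddSq dirac
  set T := S ∘L repH f - repH f ∘L S
  set W₁ := repH g₁ (hermiteH (i, n)) with hW₁
  set W₂ := repH g₂ (hermiteH (i, n)) with hW₂
  set r : ℝ := 2 * n + 1 with hr
  have hr0 : 0 < r := by positivity
  have hS : IsSelfAdjoint S := (invSqrtOneAddSq_nonneg dirac).isSelfAdjoint
  have hcoef : ∀ k, ⟪hermiteH k, T (hermiteH (i, n))⟫_ℂ =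
      ((diracEig k - diracEig (i, n) : ℝ) : ℂ) * ⟪hermiteH k, repH f (hermiteH (i, n))⟫_ℂ := by
    intro k
    have h1 : ⟪hermiteH k, S (repH f (hermiteH (i, n)))⟫_ℂ =
        ⟪S (hermiteH k), repH f (hermiteH (i, n))⟫_ℂ := (hS.isSymmetric _ _).symm
    change ⟪hermiteH k, S (repH f (hermiteH (i, n))) - repH f (S (hermiteH (i, n)))⟫_ℂ = _
    rw [inner_sub_right, h1, invSqrtOneAddSq_hermiteH, invSqrtOneAddSq_hermiteH, inner_smul_left,
      map_smul, inner_smul_right, Complex.conj_ofReal]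
    push_cast
    ring
  -- For different components the coefficient vanishes because `π(f)` is diagonal. In the same
  -- component `hg` on two eigenvectors produces `λₘ - λₙ`, which cancels against the difference of
  -- eigenvalues.
  have hbound : ∀ k : (SignType × Fin 2) × ℕ, ‖⟪hermiteH k, T (hermiteH (i, n))⟫_ℂ‖ ≤
      r⁻¹ * (2 * ‖⟪hermiteH (k.1, k.2 + 1), W₁⟫_ℂ‖ + ‖⟪hermiteH k, W₂⟫_ℂ‖) := by
    rintro ⟨k, m⟩
    rw [hcoef]
    by_cases hk : k = i
    · subst hk
      have hX := hg (hermiteS m) (hermiteS n)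
      rw [oscS_hermiteS, oscS_hermiteS, raiseS_hermiteS, map_smul, map_smul, map_smul, map_smul,
        inner_smul_left, inner_smul_left, inner_smul_right, Complex.conj_ofReal,
        Complex.conj_ofReal, ← sub_mul, ← Complex.ofReal_sub, ← inner_repH_same k,
        ← inner_repH_same k, ← inner_repH_same k] at hX
      have hX' : |(2 * m + 1 : ℝ) - r| * ‖⟪hermiteH (k, m), repH f (hermiteH (k, n))⟫_ℂ‖ ≤
          √(2 * m + 2) * ‖⟪hermiteH (k, m + 1), W₁⟫_ℂ‖ + ‖⟪hermiteH (k, m), W₂⟫_ℂ‖ := by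
        have := congrArg norm hX
        rw [norm_mul, Complex.norm_real, Real.norm_eq_abs] at this
        refine this.trans_le ((norm_add_le _ _).trans_eq ?_)
        rw [norm_mul, Complex.norm_real, Real.norm_of_nonneg (Real.sqrt_nonneg _)]
        rfl
      have hm0 : (0 : ℝ) < 2 * m + 1 := by positivity
      have hμ := abs_inv_sqrt_sub_inv_sqrt_le hm0 hr0
        (by positivity : (0 : ℝ) ≤ 2 * ((k.2 : ℕ) : ℝ))
      -- The half power of `2m + 1` absorbs the growth `√(2m + 2)` of the raising operator, since
      -- `2m + 2 ≤ 4(2m + 1)`.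
      have hs1 : (√(2 * m + 1 : ℝ))⁻¹ * √(2 * m + 2) ≤ 2 := by
        rw [inv_mul_le_iff₀ (by positivity), Real.sqrt_le_left (by positivity), mul_pow,
          Real.sq_sqrt hm0.le]
        linarith
      have hs2 : (√(2 * m + 1 : ℝ))⁻¹ ≤ 1 :=
        inv_le_one_of_one_le₀ (Real.one_le_sqrt.2 (by linarith [(Nat.cast_nonneg m : (0 : ℝ) ≤ m)]))
      rw [norm_mul, Complex.norm_real, Real.norm_eq_abs]
      calc _ ≤ r⁻¹ * (√(2 * m + 1 : ℝ))⁻¹ * |(2 * m + 1 : ℝ) - r| *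
            ‖⟪hermiteH (k, m), repH f (hermiteH (k, n))⟫_ℂ‖ :=
            mul_le_mul_of_nonneg_right hμ (norm_nonneg _)
        _ = r⁻¹ * (√(2 * m + 1 : ℝ))⁻¹ * (|(2 * m + 1 : ℝ) - r| *
            ‖⟪hermiteH (k, m), repH f (hermiteH (k, n))⟫_ℂ‖) := by ring
        _ ≤ r⁻¹ * (√(2 * m + 1 : ℝ))⁻¹ * (√(2 * m + 2) * ‖⟪hermiteH (k, m + 1), W₁⟫_ℂ‖ +
            ‖⟪hermiteH (k, m), W₂⟫_ℂ‖) := by gcongr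
        _ = r⁻¹ * ((√(2 * m + 1 : ℝ))⁻¹ * √(2 * m + 2) * ‖⟪hermiteH (k, m + 1), W₁⟫_ℂ‖ +
            (√(2 * m + 1 : ℝ))⁻¹ * ‖⟪hermiteH (k, m), W₂⟫_ℂ‖) := by ring
        _ ≤ r⁻¹ * (2 * ‖⟪hermiteH (k, m + 1), W₁⟫_ℂ‖ + 1 * ‖⟪hermiteH (k, m), W₂⟫_ℂ‖) := by
            gcongr
        _ = _ := by rw [one_mul]
    · rw [hermiteH, hermiteH, inner_repH_of_ne hk, mul_zero, norm_zero]
      positivity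
  have hshift : Orthonormal ℂ fun k : (SignType × Fin 2) × ℕ => hermiteH (k.1, k.2 + 1) :=
    orthonormal_hermiteH.comp (fun k : (SignType × Fin 2) × ℕ => (k.1, k.2 + 1))
      fun k l h => by
        simp only [Prod.mk.injEq, add_left_inj] at h
        exact Prod.ext h.1 h.2
  have hT : ‖T (hermiteH (i, n))‖ ≤ r⁻¹ * (3 * ‖W₁‖ + 2 * ‖W₂‖) := by
    -- By `(2x + y)² ≤ 8x² + 2y²`, Bessel applies separately to the shifted and unshifted families.
    -- Finally `8x² + 2y² ≤ (3x + 2y)²` for `x, y ≥ 0`.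
    refine norm_le_of_sum_inner_le hermiteBasis _ (by positivity) fun s => ?_
    calc ∑ k ∈ s, ‖⟪hermiteBasis k, T (hermiteH (i, n))⟫_ℂ‖ ^ 2
        ≤ ∑ k ∈ s, (r⁻¹) ^ 2 * (8 * ‖⟪hermiteH (k.1, k.2 + 1), W₁⟫_ℂ‖ ^ 2 +
          2 * ‖⟪hermiteH k, W₂⟫_ℂ‖ ^ 2) := by
          refine Finset.sum_le_sum fun k _ => ?_
          rw [hermiteBasis_apply]
          refine (pow_le_pow_left₀ (norm_nonneg _) (hbound k) 2).trans ?_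
          rw [mul_pow]
          refine mul_le_mul_of_nonneg_left ?_ (by positivity)
          nlinarith [sq_nonneg (2 * ‖⟪hermiteH (k.1, k.2 + 1), W₁⟫_ℂ‖ - ‖⟪hermiteH k, W₂⟫_ℂ‖)]
      _ = (r⁻¹) ^ 2 * (8 * ∑ k ∈ s, ‖⟪hermiteH (k.1, k.2 + 1), W₁⟫_ℂ‖ ^ 2 +
          2 * ∑ k ∈ s, ‖⟪hermiteH k, W₂⟫_ℂ‖ ^ 2) := by
          rw [← Finset.mul_sum, Finset.sum_add_distrib, ← Finset.mul_sum, ← Finset.mul_sum]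
      _ ≤ (r⁻¹) ^ 2 * (8 * ‖W₁‖ ^ 2 + 2 * ‖W₂‖ ^ 2) := by
          gcongr
          · exact hshift.sum_inner_products_le W₁
          · exact orthonormal_hermiteH.sum_inner_products_le W₂
      _ ≤ _ := by
          rw [mul_pow]
          refine mul_le_mul_of_nonneg_left ?_ (by positivity)
          nlinarith [mul_nonneg (norm_nonneg W₁) (norm_nonneg W₂), sq_nonneg ‖W₁‖, sq_nonneg ‖W₂‖]
  have hN₁ : ‖W₁‖ ≤ C₁ * r ^ (-(1 / 4) : ℝ) := by
    rw [hW₁, hermiteH, norm_repH_embS_single]; exact h₁ n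
  have hN₂ : ‖W₂‖ ≤ C₂ * r ^ (-(1 / 4) : ℝ) := by
    rw [hW₂, hermiteH, norm_repH_embS_single]; exact h₂ n
  calc _ ≤ r⁻¹ * (3 * ‖W₁‖ + 2 * ‖W₂‖) := hT
    _ ≤ r⁻¹ * (3 * (C₁ * r ^ (-(1 / 4) : ℝ)) + 2 * (C₂ * r ^ (-(1 / 4) : ℝ))) := by gcongr
    _ = (3 * C₁ + 2 * C₂) * (r ^ (-1 : ℝ) * r ^ (-(1 / 4) : ℝ)) := by
      rw [Real.rpow_neg_one]; ring
    _ = _ := by rw [← Real.rpow_add hr0]; norm_num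

lemma summable_two_mul_add_one_rpow : Summable fun n : ℕ => (2 * n + 1 : ℝ) ^ (-(5 / 4) : ℝ) := by
  have h : Summable fun n : ℕ => (n : ℝ) ^ (-(5 / 4) : ℝ) :=
    Real.summable_nat_rpow.2 (by norm_num)
  have h2 := h.comp_injective (i := fun n : ℕ => 2 * n + 1) fun a b hab => by
    simp only at hab; omega
  refine h2.congr fun n => ?_
  simp

end Commutator

end KappaAffine

end

/-- For every `f ∈ 𝒜` the commutator `[(1 + 𝒟²)^(-1/2), π(f)]` is trace class. -/
theorem lemma4p8 (f : KappaAffine.smoothAlgebra) :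
    KappaAffine.IsTraceClass
      (KappaAffine.invSqrtOneAddSq KappaAffine.dirac ∘L KappaAffine.repH f -
        KappaAffine.repH f ∘L KappaAffine.invSqrtOneAddSq KappaAffine.dirac) := by
  choose C hC0 hC using KappaAffine.exists_norm_commutator_hermiteH_le f
  refine KappaAffine.isTraceClass_of_summable_norm KappaAffine.hermiteBasis _ ?_
  -- There are only six components, so the sum over the basis is a finite sum of constants times a
  -- convergent series in `n`.
  have hs : Summable C := Summable.of_finite
  refine Summable.of_nonneg_of_le (fun _ => norm_nonneg _) (fun k => ?_)
    (hs.mul_of_nonneg KappaAffine.summable_two_mul_add_one_rpow hC0 fun n => by positivity)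
  rw [KappaAffine.hermiteBasis_apply]
  exact hC k.1 k.2
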